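/- Let $F_n$ be the free group of rank $n$. An element of a free group $G$ is called primitive in $G$ if it belongs to some basis (free generating set) of $G$. A subgroup $H \le F_n$ is called a free factor of $F_n$ if some basis of $H$ can be extended to a basis of $F_n$. Let $H \le F_n$ be a finitely generated subgroup, and suppose that every element of $H$ which is primitive in $H$ is also primitive in $F_n$. Then $H$ is a free factor of $F_n$. -/

import Mathlib

universe u

/-- An element of a group `G` is primitive if it belongs to some free basis of `G`. -/
def IsPrimitiveElement {G : Type u} [Group G] (g : G) : Prop :=
  ∃ (ι : Type u) (b : FreeGroupBasis ι G) (i : ι), b i = g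

/-- A subgroup `H` of a group `F` is a free factor if some free basis of `H` can be extended
to a free basis of `F`. -/
def IsFreeFactor {F : Type u} [Group F] (H : Subgroup F) : Prop :=
  ∃ (ι κ : Type u) (b : FreeGroupBasis ι H) (c : FreeGroupBasis (ι ⊕ κ) F),
    ∀ i : ι, c (Sum.inl i) = (b i : F)

/-! Take a basis b_1, ..., b_k of H. For v generated by the b_i with i < j, the product b_j v is
primitive in H, hence in F_n. This consequence already suffices (`exists_basis_extending`): the b_j
are adjoined one at a time, in coordinates where the predecessors form a set J of generators. The
step is `extendsBasis_of_isPrimitiveElement`: if h v is primitive for all v in ⟨J⟩, then J together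
with h is part of a basis.

For this step, h is shortened by automorphisms fixing J and by multiplication with ⟨J⟩ on both
sides. Suppose h is shortest and longer than one letter. Multiply it by a v in ⟨J⟩ whose turns tie
all J-letters together, even after one letter is deleted. The Whitehead graph of the cyclic word h v
(vertices the letters, edges the turns) is disconnected or has a cut vertex, because h v is
primitive. The J-letters stay together, so one side of the cut contains none of them, and Whitehead
automorphisms along this cut shorten h (`exists_relEquiv_of_cut`), a contradiction.

The cut vertex lemma (`exists_cut_of_isCutting`) is proved in the Cayley tree. If w belongs to a
basis, the half-space of another basis element is a set S with finite edge boundary, invariant under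
right multiplication by w, so S separates the ends of no translate of the axis of w. Its flow is an
exponent sum, which shows that S is not trivial. Choose such an S with minimal boundary and a
deepest vertex u below which S is not constant. By minimality S splits the children of u into two
nonempty families, both reached by letters in use, while axes through u making a turn join only
children of the same family. The direction from u to the root is the only possible link, hence the
cut vertex. -/

namespace FreeGroup

/-! ### Reduced words and cones in the Cayley tree. -/

variable {α : Type*}

/-- The inverse of a letter. -/
def invLetter (l : α × Bool) : α × Bool := (l.1, !l.2)

@[simp] lemma invLetter_fst (l : α × Bool) : (invLetter l).1 = l.1 := rfl

@[simp] lemma invLetter_snd (l : α × Bool) : (invLetter l).2 = !l.2 := rfl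

@[simp] lemma invLetter_invLetter (l : α × Bool) : invLetter (invLetter l) = l := by
  simp [invLetter]

lemma invLetter_ne (l : α × Bool) : invLetter l ≠ l := by
  intro h
  have := congrArg Prod.snd h
  simp at this

lemma invLetter_eq_iff {l m : α × Bool} : invLetter l = m ↔ l = invLetter m :=
  ⟨fun h => by rw [← h, invLetter_invLetter], fun h => by rw [h, invLetter_invLetter]⟩

lemma mk_invLetter (l : α × Bool) : mk [invLetter l] = (mk [l])⁻¹ := by
  simp [inv_mk, invRev, invLetter]

lemma isReduced_pair_iff {a b : α × Bool} : IsReduced [a, b] ↔ b ≠ invLetter a := by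
  obtain ⟨a, s⟩ := a
  obtain ⟨b, t⟩ := b
  cases s <;> cases t <;> simp [isReduced_cons_cons, invLetter, eq_comm]

variable [DecidableEq α]

lemma toWord_mk_of_isReduced {W : List (α × Bool)} (h : IsReduced W) : (mk W).toWord = W := by
  rw [toWord_mk, h.reduce_eq]

lemma toWord_mul_mk {g : FreeGroup α} {W : List (α × Bool)} (h : IsReduced (g.toWord ++ W)) :
    (g * mk W).toWord = g.toWord ++ W := by
  conv_lhs => rw [← mk_toWord (x := g), mul_mk]
  exact toWord_mk_of_isReduced h

lemma toWord_mul_letter (g : FreeGroup α) (l : α × Bool) :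
    (g * mk [l]).toWord = g.toWord ++ [l] ∨ g.toWord = (g * mk [l]).toWord ++ [invLetter l] := by
  rcases List.eq_nil_or_concat g.toWord with h | ⟨P, m, h⟩
  · left
    apply toWord_mul_mk
    simp [h]
  · by_cases hm : m = invLetter l
    · right
      have hg : g = mk P * mk [invLetter l] := by
        rw [mul_mk, ← hm, ← List.concat_eq_append, ← h, mk_toWord]
      have hP : IsReduced P :=
        (isReduced_toWord (x := g)).infix ⟨[], [m], by simp [h]⟩
      have : g * mk [l] = mk P := by
        rw [hg, mk_invLetter, inv_mul_cancel_right]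
      rw [this, toWord_mk_of_isReduced hP, h, hm, List.concat_eq_append]
    · left
      apply toWord_mul_mk
      have h1 : IsReduced (P ++ [m]) := by
        rw [← List.concat_eq_append, ← h]
        exact isReduced_toWord
      have h2 : IsReduced ([m] ++ [l]) := by
        apply isReduced_pair_iff.2
        rintro rfl
        exact hm (invLetter_invLetter m).symm
      rw [h, List.concat_eq_append]
      exact h1.append_overlap h2 (by simp)

/-- The elements whose reduced word extends the reduced word of `u`. -/
def cone (u : FreeGroup α) : Set (FreeGroup α) := {g | u.toWord <+: g.toWord}

/-- The letters leading from `u` back to the root; there is at most one. -/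
def backLetters (u : FreeGroup α) : Set (α × Bool) := {l | u.toWord.getLast? = some (invLetter l)}

lemma backLetters_subsingleton (u : FreeGroup α) : (backLetters u).Subsingleton := by
  intro l hl m hm
  have := hl.symm.trans hm
  simpa [invLetter_eq_iff] using this

lemma isReduced_append_of_notMem_backLetters {u : FreeGroup α} {l : α × Bool}
    {W : List (α × Bool)} (hl : l ∉ backLetters u) (hW : IsReduced (l :: W)) :
    IsReduced (u.toWord ++ l :: W) := by
  refine isReduced_toWord.append hW ?_
  intro a ha b hb
  have hb : l = b := by simpa using hb
  subst hb
  have := isReduced_pair_iff (a := a) (b := l)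
  rw [isReduced_cons_cons] at this
  refine (this.2 ?_).1
  rintro rfl
  exact hl (by simpa [backLetters] using ha)

lemma toWord_mul_mk_cons {u : FreeGroup α} {l : α × Bool} {W : List (α × Bool)}
    (hl : l ∉ backLetters u) (hW : IsReduced (l :: W)) :
    (u * mk (l :: W)).toWord = u.toWord ++ l :: W :=
  toWord_mul_mk (isReduced_append_of_notMem_backLetters hl hW)

lemma toWord_mul_letter_of_notMem {u : FreeGroup α} {l : α × Bool} (hl : l ∉ backLetters u) :
    (u * mk [l]).toWord = u.toWord ++ [l] :=
  toWord_mul_mk_cons hl IsReduced.singleton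

lemma mem_cone_self (u : FreeGroup α) : u ∈ cone u := List.prefix_refl _

lemma cone_one : cone (1 : FreeGroup α) = Set.univ := by
  ext g
  simp [cone]

lemma cone_mul_letter_subset {u : FreeGroup α} {l : α × Bool} (hl : l ∉ backLetters u) :
    cone (u * mk [l]) ⊆ cone u := by
  intro g hg
  refine List.IsPrefix.trans ?_ hg
  rw [toWord_mul_letter_of_notMem hl]
  exact List.prefix_append _ _

lemma notMem_cone_mul_letter {u : FreeGroup α} {l : α × Bool} (hl : l ∉ backLetters u) :
    u ∉ cone (u * mk [l]) := by
  intro h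
  have := List.IsPrefix.length_le h
  rw [toWord_mul_letter_of_notMem hl] at this
  simp at this

lemma mul_mk_cons_mem_cone {u : FreeGroup α} {l : α × Bool} {W : List (α × Bool)}
    (hl : l ∉ backLetters u) (hW : IsReduced (l :: W)) :
    u * mk (l :: W) ∈ cone (u * mk [l]) := by
  rw [cone, Set.mem_ofPred_eq, toWord_mul_mk_cons hl hW, toWord_mul_letter_of_notMem hl]
  exact ⟨W, by simp⟩

lemma exists_mem_cone_mul_letter {u g : FreeGroup α} (hg : g ∈ cone u) (hne : g ≠ u) :
    ∃ l, l ∉ backLetters u ∧ g ∈ cone (u * mk [l]) := by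
  obtain ⟨W, hW⟩ := hg
  rcases W with - | ⟨l, W⟩
  · exact absurd (toWord_injective (by simpa using hW.symm)) hne
  · have hr : IsReduced (u.toWord ++ l :: W) := hW ▸ isReduced_toWord
    have hl : l ∉ backLetters u := by
      intro hl
      obtain ⟨P, hP⟩ := List.getLast?_eq_some_iff.1 hl
      have := hr.infix (L₁ := [invLetter l, l]) ⟨P, W, by simp [hP]⟩
      rw [isReduced_pair_iff] at this
      simp at this
    exact ⟨l, hl, W, by rw [toWord_mul_letter_of_notMem hl, ← hW]; simp⟩

/-- A cone can only be left through its apex. -/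
lemma eq_of_mem_cone_of_mul_letter_notMem {u g : FreeGroup α} {l : α × Bool} (hg : g ∈ cone u)
    (hgl : g * mk [l] ∉ cone u) : g = u ∧ l ∈ backLetters u := by
  rcases toWord_mul_letter g l with h | h
  · refine absurd ?_ hgl
    rw [cone, Set.mem_ofPred_eq, h]
    exact List.IsPrefix.trans hg (List.prefix_append _ _)
  · rcases List.prefix_concat_iff.1 (by rw [← h]; exact hg : u.toWord <+: _) with h' | h'
    · have : g = u := toWord_injective (h.trans h'.symm)
      subst this
      exact ⟨rfl, by rw [backLetters, Set.mem_ofPred_eq, h]; simp⟩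
    · exact absurd h' hgl

lemma cone_induction {u : FreeGroup α} {C : FreeGroup α → Prop} (base : C u)
    (step : ∀ g ∈ cone u, ∀ l, g * mk [l] ∈ cone u → C g → C (g * mk [l]))
    {g : FreeGroup α} (hg : g ∈ cone u) : C g := by
  obtain ⟨W, hW⟩ := hg
  induction W using List.reverseRecOn generalizing g with
  | nil => rwa [toWord_injective (by simpa using hW.symm : g.toWord = u.toWord)]
  | append_singleton W l ih =>
    have hr : IsReduced (u.toWord ++ W) :=
      (isReduced_toWord (x := g)).infix ⟨[], [l], by simp [← hW]⟩
    have hw : (mk (u.toWord ++ W)).toWord = u.toWord ++ W := toWord_mk_of_isReduced hr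
    have hg : g = mk (u.toWord ++ W) * mk [l] := by
      rw [mul_mk, List.append_assoc, hW, mk_toWord]
    rw [hg]
    refine step _ ⟨W, hw.symm⟩ l ?_ (ih hw.symm)
    rw [← hg]
    exact ⟨_, hW⟩

end FreeGroup

namespace FreeGroup

/-! ### Almost invariant sets: ends, flow and edge boundary. -/

open Filter

section Ends

variable {G : Type*}

open Classical in
/-- The indicator function of a set with integer values. -/
noncomputable def indic (S : Set G) (g : G) : ℤ := if g ∈ S then 1 else 0

lemma indic_congr {H : Type*} {S : Set G} {T : Set H} {g : G} {h : H} (hgh : g ∈ S ↔ h ∈ T) : indic S g = indic T h := by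
  by_cases hT : h ∈ T <;> simp [indic, hgh, hT]

variable [Group G]

/-- Along every translate of the axis of `w`, both ends lie in `S` or both lie outside `S`. -/
def EndsAgree (S : Set G) (w : G) : Prop :=
  ∀ g, ∀ᶠ k : ℕ in atTop, (g * w ^ k ∈ S ↔ g * (w ^ k)⁻¹ ∈ S)

lemma EndsAgree.compl {S : Set G} {w : G} (h : EndsAgree S w) : EndsAgree Sᶜ w := by
  intro g
  filter_upwards [h g] with k hk
  simp [hk]

/-- The flow of the set `S` under right translation by `g`. -/
noncomputable def flow (S : Set G) (g : G) : ℤ := ∑ᶠ u, (indic S (u * g) - indic S u)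

lemma support_flow (S : Set G) (g : G) :
    (Function.support fun u => indic S (u * g) - indic S u) = {u | ¬(u * g ∈ S ↔ u ∈ S)} := by
  ext u
  by_cases h1 : u * g ∈ S <;> by_cases h2 : u ∈ S <;> simp [indic, h1, h2]

lemma flow_compl (S : Set G) (g : G) : flow Sᶜ g = -flow S g := by
  rw [flow, flow, ← finsum_neg_distrib]
  congr 1
  ext u
  by_cases h1 : u * g ∈ S <;> by_cases h2 : u ∈ S <;> simp [indic, h1, h2]

/-- The sums telescope once the one for `h` is reindexed by u ↦ u g; finiteness is what makes
`finsum` additive here. -/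
lemma flow_mul {S : Set G} {g h : G} (hg : {u | ¬(u * g ∈ S ↔ u ∈ S)}.Finite)
    (hh : {u | ¬(u * h ∈ S ↔ u ∈ S)}.Finite) : flow S (g * h) = flow S g + flow S h := by
  have h1 : flow S h = ∑ᶠ u, (indic S (u * g * h) - indic S (u * g)) :=
    (finsum_comp_equiv (Equiv.mulRight g)
      (f := fun u => indic S (u * h) - indic S u)).symm
  have h2 : (Function.support fun u => indic S (u * g * h) - indic S (u * g)).Finite := by
    have := (support_flow S h ▸ hh).preimage (Equiv.mulRight g).injective.injOn
    exact this.subset fun u hu => hu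
  rw [h1, flow, flow, ← finsum_add_distrib ((support_flow S g).symm ▸ hg : Set.Finite _) h2]
  congr 1
  ext u
  rw [mul_assoc]
  ring

/-- Away from the single point `u`, `T` is the disjoint union of `S` and `D`. The invariant set `D`
contributes zero termwise. The correction at `u` is a finitely supported function, whose sum is
unchanged by translation. -/
lemma flow_congr_of_finite {S T : Set G} {g : G} {D : Set G} (u : G)
    (hS : {v | ¬(v * g ∈ S ↔ v ∈ S)}.Finite) (hD : ∀ v, v * g ∈ D ↔ v ∈ D)
    (h : ∀ v, v ≠ u → (v ∈ T ↔ v ∈ S ∨ v ∈ D)) (hdisj : Disjoint S D) : flow T g = flow S g := by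
  have key : ∃ c : ℤ, ∀ v, indic T v = indic S v + indic D v + c * indic {u} v := by
    refine ⟨indic T u - indic S u - indic D u, fun v => ?_⟩
    by_cases hv : v = u
    · subst hv
      simp [indic]
    · have hd := fun hv : v ∈ S => Set.disjoint_left.1 hdisj hv
      have ht := h v hv
      by_cases h1 : v ∈ S <;> by_cases h2 : v ∈ D <;> simp_all [indic]
  obtain ⟨c, hc⟩ := key
  have hDv : ∀ v, indic D (v * g) = indic D v := fun v => indic_congr (hD v)
  have hsing : (Function.support fun v => c * indic {u} v).Finite := by
    refine (Set.finite_singleton u).subset fun v hv => ?_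
    by_contra hvu
    simp [indic, show v ≠ u from hvu] at hv
  have hsing' : (Function.support fun v => c * indic {u} (v * g)).Finite := by
    have := hsing.preimage (Equiv.mulRight g).injective.injOn
    exact this.subset fun u hu => hu
  have h0 : ∑ᶠ v, (c * indic {u} (v * g) - c * indic {u} v) = 0 := by
    rw [finsum_sub_distrib hsing' hsing, sub_eq_zero]
    exact finsum_comp_equiv (Equiv.mulRight g) (f := fun v => c * indic {u} v)
  have hfin : (Function.support fun v => c * indic {u} (v * g) - c * indic {u} v).Finite :=
    (hsing'.union hsing).subset (Function.support_sub _ _)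
  rw [flow, flow, ← add_zero (∑ᶠ v, (indic S (v * g) - indic S v)), ← h0,
    ← finsum_add_distrib ((support_flow S g).symm ▸ hS : Set.Finite _) hfin]
  congr 1
  ext v
  rw [hc, hc, hDv]
  ring

end Ends

variable {α : Type*}

/-- The edges of the Cayley tree leaving the set `S`. -/
def edgeBoundary (S : Set (FreeGroup α)) : Set (FreeGroup α × (α × Bool)) :=
  {p | p.1 ∈ S ∧ p.1 * mk [p.2] ∉ S}

lemma edgeBoundary_compl (S : Set (FreeGroup α)) :
    edgeBoundary Sᶜ = (fun p => (p.1 * mk [p.2], invLetter p.2)) '' edgeBoundary S := by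
  ext ⟨g, l⟩
  constructor
  · rintro ⟨h1, h2⟩
    refine ⟨(g * mk [l], invLetter l), ⟨by simpa using h2, ?_⟩, ?_⟩ <;>
      simp_all [mk_invLetter, -inv_mk]
  · rintro ⟨⟨g', l'⟩, ⟨h1, h2⟩, h⟩
    obtain ⟨rfl, rfl⟩ := Prod.ext_iff.1 h
    exact ⟨h2, by simpa [mk_invLetter, -inv_mk] using h1⟩

lemma ncard_edgeBoundary_compl (S : Set (FreeGroup α)) :
    (edgeBoundary Sᶜ).ncard = (edgeBoundary S).ncard := by
  rw [edgeBoundary_compl, Set.ncard_image_of_injective]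
  rintro ⟨g, l⟩ ⟨g', l'⟩ h
  obtain ⟨h1, h2⟩ := Prod.ext_iff.1 h
  have hl : l = l' := by simpa [invLetter_eq_iff] using h2
  subst hl
  simpa using h1

lemma finite_edgeBoundary_compl {S : Set (FreeGroup α)} (h : (edgeBoundary S).Finite) :
    (edgeBoundary Sᶜ).Finite := by
  rw [edgeBoundary_compl]
  exact h.image _

lemma finite_of_finite_edgeBoundary {S : Set (FreeGroup α)} (h : (edgeBoundary S).Finite)
    (l : α × Bool) : {u | ¬(u * mk [l] ∈ S ↔ u ∈ S)}.Finite := by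
  refine ((h.image Prod.fst).union ((finite_edgeBoundary_compl h).image Prod.fst)).subset ?_
  intro u hu
  by_cases h1 : u ∈ S
  · exact Or.inl ⟨(u, l), ⟨h1, by simpa [h1] using hu⟩, rfl⟩
  · exact Or.inr ⟨(u, l), ⟨h1, by simpa [h1] using hu⟩, rfl⟩

lemma finite_edgeBoundary [Finite α] {S : Set (FreeGroup α)}
    (h : ∀ g, {u | ¬(u * g ∈ S ↔ u ∈ S)}.Finite) : (edgeBoundary S).Finite := by
  have : edgeBoundary S ⊆ ⋃ l : α × Bool, (fun u => (u, l)) '' {u | ¬(u * mk [l] ∈ S ↔ u ∈ S)} := by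
    rintro ⟨g, l⟩ ⟨h1, h2⟩
    refine Set.mem_iUnion.2 ⟨l, g, ?_, rfl⟩
    simp only [Set.mem_ofPred_eq]
    tauto
  exact (Set.finite_iUnion fun l => (h _).image _).subset this

variable [DecidableEq α]

/-- `S` is constant on the cone below `u`. -/
def ConstOn (S : Set (FreeGroup α)) (u : FreeGroup α) : Prop := ∀ g ∈ cone u, (g ∈ S ↔ u ∈ S)

/-- A cone is a connected subtree, so membership in `S` can change inside it only across a boundary
edge with both endpoints in the cone. -/
lemma constOn_of_edgeBoundary {S : Set (FreeGroup α)} {u : FreeGroup α}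
    (h : ∀ p ∈ edgeBoundary S, p.1 ∉ cone u ∨ p.1 * mk [p.2] ∉ cone u) : ConstOn S u := by
  intro g hg
  refine cone_induction (C := fun g => g ∈ S ↔ u ∈ S) Iff.rfl (fun g hg l hgl ih => ?_) hg
  · rw [← ih]
    constructor
    · intro h1
      by_contra h2
      have := h (g * mk [l], invLetter l) ⟨h1, by simpa [mk_invLetter, -inv_mk] using h2⟩
      simp [mk_invLetter, -inv_mk, hgl, hg] at this
    · intro h1
      by_contra h2
      have := h (g, l) ⟨h1, h2⟩
      simp [hgl, hg] at this

lemma exists_bound_constOn {S : Set (FreeGroup α)} (hS : (edgeBoundary S).Finite) :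
    ∃ R, ∀ u : FreeGroup α, R < norm u → ConstOn S u := by
  obtain ⟨R, hR⟩ := (hS.image fun p => norm p.1).bddAbove
  refine ⟨R, fun u hu => constOn_of_edgeBoundary fun p hp => Or.inl fun hc => ?_⟩
  have h1 := hR ⟨p, hp, rfl⟩
  have h2 : norm u ≤ norm p.1 := List.IsPrefix.length_le hc
  dsimp only at h1
  omega

/-- Below all of the finitely many boundary edges `S` is constant, so the vertices with a
non-constant cone have bounded depth and one of maximal depth exists. -/
lemma exists_deepest_not_constOn {S : Set (FreeGroup α)} (hS : (edgeBoundary S).Finite)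
    (h : ¬ConstOn S 1) :
    ∃ u, ¬ConstOn S u ∧ ∀ l ∉ backLetters u, ConstOn S (u * mk [l]) := by
  obtain ⟨R, hR⟩ := exists_bound_constOn hS
  let K : Set ℕ := {k | ∃ u, norm u = k ∧ ¬ConstOn S u}
  have hne : K.Nonempty := ⟨_, 1, rfl, h⟩
  have hb : BddAbove K := by
    refine ⟨R, ?_⟩
    rintro k ⟨u, rfl, hu⟩
    by_contra hk
    exact hu (hR u (by omega))
  obtain ⟨u, hu, hu'⟩ := Nat.sSup_mem hne hb
  refine ⟨u, hu', fun l hl => ?_⟩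
  by_contra hc
  have h1 := le_csSup hb ⟨_, rfl, hc⟩
  have h2 : norm (u * mk [l]) = norm u + 1 := by
    simp [norm, toWord_mul_letter_of_notMem hl]
  omega

end FreeGroup

namespace FreeGroup

/-! ### Cutting sets and Whitehead's cut vertex lemma. -/

open Filter

lemma eventually_mul_pow_ne {G : Type*} [Group G] [IsMulTorsionFree G] {w : G} (hw : w ≠ 1)
    (g u : G) : ∀ᶠ k : ℕ in atTop, g * w ^ k ≠ u := by
  by_cases h : ∃ k : ℕ, g * w ^ k = u
  · obtain ⟨k, hk⟩ := h
    filter_upwards [eventually_gt_atTop k] with m hm hmu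
    have := injective_pow_iff_not_isOfFinOrder.2 (not_isOfFinOrder_of_isMulTorsionFree hw)
      (mul_left_cancel (hmu.trans hk.symm))
    omega
  · push Not at h
    exact Eventually.of_forall h

variable {α : Type*}

/-- A set with finite edge boundary that does not separate the ends of any translate of the axis
of `w`, but across which some generator from `J` has nonzero flow. -/
structure IsCutting (S : Set (FreeGroup α)) (w : FreeGroup α) (J : Set α) : Prop where
  finite : (edgeBoundary S).Finite
  endsAgree : EndsAgree S w
  flow_ne : ∃ j ∈ J, flow S (of j) ≠ 0

lemma IsCutting.compl {S : Set (FreeGroup α)} {w : FreeGroup α} {J : Set α}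
    (h : IsCutting S w J) : IsCutting Sᶜ w J where
  finite := finite_edgeBoundary_compl h.finite
  endsAgree := h.endsAgree.compl
  flow_ne := by simpa [flow_compl] using h.flow_ne

variable [DecidableEq α]

lemma IsCutting.not_constOn {S : Set (FreeGroup α)} {w : FreeGroup α} {J : Set α}
    (h : IsCutting S w J) : ¬ConstOn S 1 := by
  intro hc
  obtain ⟨j, -, hj⟩ := h.flow_ne
  have : ∀ g, g ∈ S ↔ 1 ∈ S := fun g => hc g (by simp [cone_one])
  refine hj ?_
  have h0 : ∀ u, indic S (u * of j) - indic S u = 0 := fun u =>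
    sub_eq_zero.2 (indic_congr ((this _).trans (this u).symm))
  simp [flow, h0]

section Improve

variable {S : Set (FreeGroup α)} {w u : FreeGroup α} {J : Set α}

/-- Apart from `u`, the part of the cone outside `S` is a union of child cones entered by letters
not from `J`. Such a child cone can only be left by the inverse of its entering letter, so a
`J`-letter never leaves it. -/
lemma mul_letter_mem_diff (hconst : ∀ l ∉ backLetters u, ConstOn S (u * mk [l]))
    (hused : ∀ l ∉ backLetters u, l.1 ∈ J → u * mk [l] ∈ S) {g : FreeGroup α} {m : α × Bool}
    (hm : m.1 ∈ J) (hg : g ∈ (cone u \ S) \ {u}) : g * mk [m] ∈ (cone u \ S) \ {u} := by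
  obtain ⟨⟨hgu, hgS⟩, hne⟩ := hg
  obtain ⟨l, hl, hgl⟩ := exists_mem_cone_mul_letter hgu hne
  have hlS : u * mk [l] ∉ S := fun h => hgS ((hconst l hl g hgl).2 h)
  have hlJ : l.1 ∉ J := fun h => hlS (hused l hl h)
  have hmem : g * mk [m] ∈ cone (u * mk [l]) := by
    by_contra hnot
    obtain ⟨-, hback⟩ := eq_of_mem_cone_of_mul_letter_notMem hgl hnot
    rw [backLetters, Set.mem_ofPred_eq, toWord_mul_letter_of_notMem hl] at hback
    have : l = invLetter m := by simpa using hback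
    subst this
    exact hlJ hm
  refine ⟨⟨cone_mul_letter_subset hl hmem, fun h => hlS ((hconst l hl _ hmem).1 h)⟩, ?_⟩
  intro h
  rw [Set.mem_singleton_iff] at h
  exact notMem_cone_mul_letter hl (h ▸ hmem)

lemma mul_letter_mem_diff_iff (hconst : ∀ l ∉ backLetters u, ConstOn S (u * mk [l]))
    (hused : ∀ l ∉ backLetters u, l.1 ∈ J → u * mk [l] ∈ S) {g : FreeGroup α} {m : α × Bool}
    (hm : m.1 ∈ J) : g * mk [m] ∈ (cone u \ S) \ {u} ↔ g ∈ (cone u \ S) \ {u} := by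
  refine ⟨fun h => ?_, mul_letter_mem_diff hconst hused hm⟩
  have := mul_letter_mem_diff hconst hused (m := invLetter m) hm h
  rwa [mk_invLetter, mul_inv_cancel_right] at this

lemma mul_mem_diff_iff (hconst : ∀ l ∉ backLetters u, ConstOn S (u * mk [l]))
    (hused : ∀ l ∉ backLetters u, l.1 ∈ J → u * mk [l] ∈ S) {v : FreeGroup α}
    (hv : v ∈ Subgroup.closure (of '' J)) (g : FreeGroup α) :
    g * v ∈ (cone u \ S) \ {u} ↔ g ∈ (cone u \ S) \ {u} := by
  induction hv using Subgroup.closure_induction generalizing g with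
  | mem x hx =>
    obtain ⟨j, hj, rfl⟩ := hx
    exact mul_letter_mem_diff_iff hconst hused (m := (j, true)) hj
  | one => rw [mul_one]
  | mul x y _ _ hx hy => rw [← mul_assoc, hy, hx]
  | inv x _ hx => rw [← hx (g * x⁻¹), inv_mul_cancel_right]

lemma mem_union_cone_iff {g : FreeGroup α} (hg : g ≠ u) :
    g ∈ S ∪ cone u ↔ g ∈ S ∨ g ∈ (cone u \ S) \ {u} := by
  by_cases h : g ∈ S <;> simp [h, hg]

/-- Adding the cone changes `S` by a set invariant under ⟨`J`⟩, which contains `w`, and possibly by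
the point `u`, which is eventually avoided in both directions along the axis. -/
lemma endsAgree_union_cone (hconst : ∀ l ∉ backLetters u, ConstOn S (u * mk [l]))
    (hused : ∀ l ∉ backLetters u, l.1 ∈ J → u * mk [l] ∈ S) (h : EndsAgree S w) (hw : w ≠ 1)
    (hwJ : w ∈ Subgroup.closure (of '' J)) : EndsAgree (S ∪ cone u) w := by
  intro g
  filter_upwards [h g, eventually_mul_pow_ne hw g u, eventually_mul_pow_ne (inv_ne_one.2 hw) g u]
    with k hk h1 h2
  rw [inv_pow] at h2
  rw [mem_union_cone_iff h1, mem_union_cone_iff h2, hk,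
    mul_mem_diff_iff hconst hused (pow_mem hwJ k),
    mul_mem_diff_iff hconst hused (inv_mem (pow_mem hwJ k))]

lemma flow_union_cone (hconst : ∀ l ∉ backLetters u, ConstOn S (u * mk [l]))
    (hused : ∀ l ∉ backLetters u, l.1 ∈ J → u * mk [l] ∈ S) (hS : (edgeBoundary S).Finite)
    {j : α} (hj : j ∈ J) : flow (S ∪ cone u) (of j) = flow S (of j) := by
  refine flow_congr_of_finite u (finite_of_finite_edgeBoundary hS (j, true))
    (D := (cone u \ S) \ {u}) ?_ ?_ ?_
  · exact fun v => mul_letter_mem_diff_iff hconst hused (m := (j, true)) hj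
  · exact fun v hv => mem_union_cone_iff hv
  · exact Set.disjoint_left.2 fun g hg h => h.1.2 hg

/-- The only edge leaving the cone is the one from `u` towards the root, so this is the only
possible new boundary edge, and it is new only if `u` was outside `S`. -/
lemma edgeBoundary_union_cone_subset :
    edgeBoundary (S ∪ cone u) ⊆
      {p ∈ edgeBoundary S | p.1 ∉ cone u ∨ p.2 ∈ backLetters u} ∪
        {p | p.1 = u ∧ u ∉ S ∧ p.2 ∈ backLetters u} := by
  rintro ⟨g, l⟩ ⟨h1, h2⟩
  simp only [Set.mem_union, not_or] at h1 h2
  by_cases hgu : g ∈ cone u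
  · obtain ⟨rfl, hl⟩ := eq_of_mem_cone_of_mul_letter_notMem hgu h2.2
    by_cases hg : g ∈ S
    · exact Or.inl ⟨⟨hg, h2.1⟩, Or.inr hl⟩
    · exact Or.inr ⟨rfl, hg, hl⟩
  · exact Or.inl ⟨⟨h1.resolve_right hgu, h2.1⟩, Or.inl hgu⟩

lemma finite_edgeBoundary_union_cone (hS : (edgeBoundary S).Finite) :
    (edgeBoundary (S ∪ cone u)).Finite := by
  refine ((hS.subset fun p hp => hp.1).union (Set.Subsingleton.finite ?_)).subset
    edgeBoundary_union_cone_subset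
  rintro ⟨g, l⟩ ⟨h1, -, h2⟩ ⟨g', l'⟩ ⟨h1', -, h2'⟩
  exact Prod.ext (h1.trans h1'.symm) (backLetters_subsingleton u h2 h2')

lemma exists_pair_letters (hJ : J.Nontrivial) (u : FreeGroup α) :
    ∃ l m : α × Bool, l ≠ m ∧ l.1 ∈ J ∧ m.1 ∈ J ∧ l ∉ backLetters u ∧ m ∉ backLetters u := by
  obtain ⟨i, hi, j, hj, hij⟩ := hJ
  by_cases h : ∃ s, (i, s) ∈ backLetters u
  · obtain ⟨s, hs⟩ := h
    refine ⟨(j, true), (j, false), by simp, hj, hj, ?_, ?_⟩ <;>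
    · intro h'
      have := backLetters_subsingleton u hs h'
      simp_all
  · push Not at h
    exact ⟨(i, true), (i, false), by simp, hi, hi, h _, h _⟩

/-- If `u` lies in `S`, no edge is gained and an edge to a child outside `S` is lost. Otherwise at
most one edge is gained, and the edges to `u` from two children along `J`-letters are lost; this is
where `J` needs two elements. -/
lemma ncard_edgeBoundary_union_cone_lt (hu : ¬ConstOn S u)
    (hconst : ∀ l ∉ backLetters u, ConstOn S (u * mk [l]))
    (hused : ∀ l ∉ backLetters u, l.1 ∈ J → u * mk [l] ∈ S) (hS : (edgeBoundary S).Finite)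
    (hJ : J.Nontrivial) : (edgeBoundary (S ∪ cone u)).ncard < (edgeBoundary S).ncard := by
  by_cases huS : u ∈ S
  · obtain ⟨l, hl, hlS⟩ : ∃ l ∉ backLetters u, u * mk [l] ∉ S := by
      by_contra! hall
      refine hu fun g hg => ?_
      by_cases hgu : g = u
      · rw [hgu]
      · obtain ⟨l, hl, hgl⟩ := exists_mem_cone_mul_letter hg hgu
        simp [(hconst l hl g hgl).2 (hall l hl), huS]
    refine Set.ncard_lt_ncard ⟨fun p hp => ?_, fun hsub => ?_⟩ hS
    · rcases edgeBoundary_union_cone_subset hp with h | h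
      · exact h.1
      · exact absurd huS h.2.1
    · rcases edgeBoundary_union_cone_subset (hsub (⟨huS, hlS⟩ : (u, l) ∈ edgeBoundary S)) with h | h
      · rcases h.2 with h | h
        · exact h (mem_cone_self u)
        · exact hl h
      · exact hl h.2.2
  · obtain ⟨l, m, hlm, hlJ, hmJ, hl, hm⟩ := exists_pair_letters hJ u
    have hin : ∀ l : α × Bool, l.1 ∈ J → l ∉ backLetters u →
        (u * mk [l], invLetter l) ∈ edgeBoundary S :=
      fun l hlJ hl => ⟨hused l hl hlJ, by simpa [mk_invLetter, -inv_mk] using huS⟩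
    have hout : ∀ l : α × Bool, l ∉ backLetters u →
        (u * mk [l], invLetter l) ∉ edgeBoundary (S ∪ cone u) := by
      intro l hl h
      apply h.2
      simp [mk_invLetter, -inv_mk, mem_cone_self]
    have hsub : edgeBoundary (S ∪ cone u) ⊆
        (edgeBoundary S \ {(u * mk [l], invLetter l), (u * mk [m], invLetter m)}) ∪
          {p | p.1 = u ∧ u ∉ S ∧ p.2 ∈ backLetters u} := by
      intro p hp
      rcases edgeBoundary_union_cone_subset hp with h | h
      · refine Or.inl ⟨h.1, ?_⟩
        rintro (rfl | rfl)
        · exact hout l hl hp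
        · exact hout m hm hp
      · exact Or.inr h
    have hsing : {p : FreeGroup α × (α × Bool) | p.1 = u ∧ u ∉ S ∧ p.2 ∈ backLetters u}.Subsingleton := by
      rintro ⟨g, l⟩ ⟨h1, -, h2⟩ ⟨g', l'⟩ ⟨h1', -, h2'⟩
      exact Prod.ext (h1.trans h1'.symm) (backLetters_subsingleton u h2 h2')
    have hpair : ({(u * mk [l], invLetter l), (u * mk [m], invLetter m)} :
        Set (FreeGroup α × (α × Bool))) ⊆ edgeBoundary S := by
      rintro p (rfl | rfl)
      · exact hin l hlJ hl
      · exact hin m hmJ hm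
    have h2 : ({(u * mk [l], invLetter l), (u * mk [m], invLetter m)} :
        Set (FreeGroup α × (α × Bool))).ncard = 2 := by
      apply Set.ncard_pair
      intro h
      exact hlm (by simpa [invLetter_eq_iff] using congrArg Prod.snd h)
    have h3 := Set.ncard_sdiff_add_ncard_of_subset hpair hS
    have h4 := Set.ncard_le_ncard hsub ((hS.subset Set.sdiff_subset).union hsing.finite)
    have h5 := Set.ncard_union_le
      (edgeBoundary S \ {(u * mk [l], invLetter l), (u * mk [m], invLetter m)})
      {p | p.1 = u ∧ u ∉ S ∧ p.2 ∈ backLetters u}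
    have h6 := (Set.ncard_le_one hsing.finite).2 hsing
    omega

end Improve

lemma exists_used_notMem_of_isCutting {S : Set (FreeGroup α)} {w u : FreeGroup α} {J : Set α}
    (h : IsCutting S w J)
    (hmin : ∀ T, IsCutting T w J → (edgeBoundary S).ncard ≤ (edgeBoundary T).ncard)
    (hu : ¬ConstOn S u) (hconst : ∀ l ∉ backLetters u, ConstOn S (u * mk [l]))
    (hw : w ≠ 1) (hwJ : w ∈ Subgroup.closure (of '' J)) (hJ : J.Nontrivial) :
    ∃ l ∉ backLetters u, l.1 ∈ J ∧ u * mk [l] ∉ S := by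
  by_contra! hused
  have hcut : IsCutting (S ∪ cone u) w J := by
    refine ⟨finite_edgeBoundary_union_cone h.finite,
      endsAgree_union_cone hconst hused h.endsAgree hw hwJ, ?_⟩
    obtain ⟨j, hj, hne⟩ := h.flow_ne
    exact ⟨j, hj, by rwa [flow_union_cone hconst hused h.finite hj]⟩
  exact absurd (hmin _ hcut)
    (not_le.2 (ncard_edgeBoundary_union_cone_lt hu hconst hused h.finite hJ))

lemma constOn_compl {S : Set (FreeGroup α)} {u : FreeGroup α} : ConstOn Sᶜ u ↔ ConstOn S u := by
  simp [ConstOn, not_iff_not]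

/-- The cyclic word `W` passes from the letter inverse to `l` to the letter `m`. -/
def IsTurn (W : List (α × Bool)) (l m : α × Bool) : Prop := [invLetter l, m] <:+: W

/-- If both sides of a turn of a cyclically reduced word avoid the root direction of `u`, then some
translate of its axis passes through `u` making this turn. -/
lemma exists_axis_of_isTurn {W : List (α × Bool)} (hW : IsCyclicallyReduced W) {l m : α × Bool}
    (hturn : IsTurn (W ++ W) l m) {u : FreeGroup α} (hl : l ∉ backLetters u)
    (hm : m ∉ backLetters u) :
    ∃ g : FreeGroup α, ∀ k, 2 ≤ k →
      g * mk W ^ k ∈ cone (u * mk [m]) ∧ g * (mk W ^ k)⁻¹ ∈ cone (u * mk [l]) := by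
  obtain ⟨p, q, hpq⟩ := hturn
  -- This translate of the axis reaches `u` after reading `p` and the inverse of `l`. Forward it
  -- continues with `m`, backward with `l`; two periods are needed because the turn may straddle the
  -- seam of `W ++ W`.
  refine ⟨u * (mk (p ++ [invLetter l]))⁻¹, fun k hk => ?_⟩
  obtain ⟨k, rfl⟩ := Nat.exists_eq_add_of_le hk
  constructor
  · have h1 : W ++ W ++ (List.replicate k W).flatten = (List.replicate (2 + k) W).flatten := by
      simp [List.replicate_add, List.replicate_succ]
    have h2 : u * (mk (p ++ [invLetter l]))⁻¹ * mk W ^ (2 + k)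
        = u * mk (m :: (q ++ (List.replicate k W).flatten)) := by
      rw [pow_mk, ← h1, ← hpq, mul_assoc]
      congr 1
      rw [inv_mul_eq_iff_eq_mul, mul_mk]
      simp
    rw [h2]
    apply mul_mk_cons_mem_cone hm
    refine ((hW.flatten_replicate (2 + k)).isReduced).infix ⟨p ++ [invLetter l], [], ?_⟩
    rw [← h1, ← hpq]
    simp
  · have h1 : (List.replicate (2 + k) W).flatten ++ (W ++ W)
        = (List.replicate (2 + k + 2) W).flatten := by
      rw [List.replicate_add (2 + k) 2]
      simp [List.replicate_succ]
    have h2 : u * (mk (p ++ [invLetter l]))⁻¹ * (mk W ^ (2 + k))⁻¹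
        = u * mk (l :: invRev ((List.replicate (2 + k) W).flatten ++ p)) := by
      rw [pow_mk, mul_assoc, ← mul_inv_rev, mul_mk, inv_mk, ← List.append_assoc, invRev_append]
      simp [invRev, invLetter]
    rw [h2]
    apply mul_mk_cons_mem_cone hl
    have h3 : IsReduced ((List.replicate (2 + k) W).flatten ++ p ++ [invLetter l]) := by
      refine ((hW.flatten_replicate (2 + k + 2)).isReduced).infix ⟨[], [m] ++ q, ?_⟩
      rw [← h1, ← hpq]
      simp
    have h4 : l :: invRev ((List.replicate (2 + k) W).flatten ++ p)
        = invRev ((List.replicate (2 + k) W).flatten ++ p ++ [invLetter l]) := by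
      rw [invRev_append]
      simp [invRev, invLetter]
    rw [h4, isReduced_iff_reduce_eq, reduce_invRev, h3.reduce_eq]

/-- **Whitehead's cut vertex lemma**, for an element admitting a cutting set. -/
lemma exists_cut_of_isCutting {W : List (α × Bool)} {J : Set α} (hW : IsCyclicallyReduced W)
    (hcut : ∃ S, IsCutting S (mk W) J) (hne : mk W ≠ 1)
    (hwJ : mk W ∈ Subgroup.closure (of '' J)) (hJ : J.Nontrivial) :
    ∃ X A : Set (α × Bool), X.Subsingleton ∧ (∃ l ∈ A, l ∉ X ∧ l.1 ∈ J) ∧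
      (∃ l ∉ A, l ∉ X ∧ l.1 ∈ J) ∧
      ∀ l m, IsTurn (W ++ W) l m → l ∉ X → m ∉ X → (l ∈ A ↔ m ∈ A) := by
  obtain ⟨S, hS, hmin⟩ : ∃ S, IsCutting S (mk W) J ∧
      ∀ T, IsCutting T (mk W) J → (edgeBoundary S).ncard ≤ (edgeBoundary T).ncard := by
    let K : Set ℕ := {k | ∃ S, IsCutting S (mk W) J ∧ (edgeBoundary S).ncard = k}
    have hK : K.Nonempty := hcut.elim fun S hS => ⟨_, S, hS, rfl⟩
    obtain ⟨S, hS, h⟩ := Nat.sInf_mem hK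
    exact ⟨S, hS, fun T hT => h ▸ Nat.sInf_le ⟨T, hT, rfl⟩⟩
  obtain ⟨u, hu, hconst⟩ := exists_deepest_not_constOn hS.finite hS.not_constOn
  obtain ⟨l, hl, hlJ, hlS⟩ := exists_used_notMem_of_isCutting hS hmin hu hconst hne hwJ hJ
  -- The complement is a cutting set with the same boundary size and the same vertex `u`; it yields
  -- a used child on the other side.
  obtain ⟨m, hm, hmJ, hmS⟩ := exists_used_notMem_of_isCutting hS.compl (u := u)
    (by simpa only [ncard_edgeBoundary_compl] using hmin) (by rwa [constOn_compl])
    (by simpa only [constOn_compl] using hconst) hne hwJ hJ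
  refine ⟨backLetters u, {l | u * mk [l] ∈ S}, backLetters_subsingleton u,
    ⟨m, by simpa using hmS, hm, hmJ⟩, ⟨l, hlS, hl, hlJ⟩, fun l m hturn hl hm => ?_⟩
  -- The ends of this translate lie in the child cones of `m` and `l`, where `S` is constant, so
  -- agreement of the ends compares the two children.
  obtain ⟨g, hg⟩ := exists_axis_of_isTurn hW hturn hl hm
  obtain ⟨k, hk, hk2⟩ := ((hS.endsAgree g).and (eventually_ge_atTop 2)).exists
  obtain ⟨h1, h2⟩ := hg k hk2
  have h3 := hconst m hm _ h1
  have h4 := hconst l hl _ h2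
  simp only [Set.mem_ofPred_eq]
  rw [← h3, ← h4, hk]

end FreeGroup

namespace FreeGroup

/-! ### Half-spaces of basis elements as cutting sets. -/

section HalfSpace

variable {κ : Type*} [DecidableEq κ]

lemma mul_letter_mem_cone_of {k : κ} {m : κ × Bool} {g : FreeGroup κ} (hg : g ∈ cone (of k))
    (hm : m ≠ (k, false)) : g * mk [m] ∈ cone (of k) := by
  by_contra h
  have := (eq_of_mem_cone_of_mul_letter_notMem hg h).2
  simp only [backLetters, toWord_of, List.getLast?_singleton, Set.mem_ofPred_eq,
    Option.some.injEq, eq_comm (a := (k, true)), invLetter_eq_iff] at this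
  exact hm this

lemma mul_of_mem_cone_of_iff {k m : κ} (hm : m ≠ k) (g : FreeGroup κ) :
    g * of m ∈ cone (of k) ↔ g ∈ cone (of k) := by
  refine ⟨fun h => ?_, fun h => mul_letter_mem_cone_of (m := (m, true)) h (by simp)⟩
  have := mul_letter_mem_cone_of (m := invLetter (m, true)) h (by simp [invLetter, hm])
  rwa [mk_invLetter, ← of, mul_inv_cancel_right] at this

lemma mul_of_self_mem_cone_of_iff {k : κ} (g : FreeGroup κ) (hg : g ≠ 1) :
    g * of k ∈ cone (of k) ↔ g ∈ cone (of k) := by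
  refine ⟨fun h => ?_, fun h => mul_letter_mem_cone_of (m := (k, true)) h (by simp)⟩
  by_contra h'
  have h2 : g * of k * mk [invLetter (k, true)] ∉ cone (of k) := by
    rwa [mk_invLetter, ← of, mul_inv_cancel_right]
  exact hg (by simpa using (eq_of_mem_cone_of_mul_letter_notMem h h2).1)

/-- The half-space is bounded by the single edge from 1 to `of k`. -/
lemma setOf_cone_of_subset (k m : κ) :
    {u | ¬(u * of m ∈ cone (of k) ↔ u ∈ cone (of k))} ⊆ {1} := by
  intro u hu
  by_contra hne
  apply hu
  by_cases hm : m = k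
  · subst hm
    exact mul_of_self_mem_cone_of_iff u hne
  · exact mul_of_mem_cone_of_iff hm u

lemma finite_cone_of (k : κ) (g : FreeGroup κ) :
    {u | ¬(u * g ∈ cone (of k) ↔ u ∈ cone (of k))}.Finite := by
  have hinv : ∀ g : FreeGroup κ, {u | ¬(u * g ∈ cone (of k) ↔ u ∈ cone (of k))}.Finite →
      {u | ¬(u * g⁻¹ ∈ cone (of k) ↔ u ∈ cone (of k))}.Finite := by
    intro g hg
    refine (hg.preimage (Equiv.mulRight g⁻¹).injective.injOn).subset fun u hu => ?_
    simpa [iff_comm] using hu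
  induction g using FreeGroup.induction_on with
  | C1 => simp
  | of m => exact (Set.finite_singleton 1).subset (setOf_cone_of_subset k m)
  | inv_of m _ => exact hinv _ ((Set.finite_singleton 1).subset (setOf_cone_of_subset k m))
  | mul g h hg hh =>
    refine (hg.union (hh.preimage (Equiv.mulRight g).injective.injOn)).subset fun u hu => ?_
    simp only [Set.mem_ofPred_eq, Set.mem_union, Set.mem_preimage, Equiv.coe_mulRight,
      ← mul_assoc] at hu ⊢
    tauto

/-- The exponent sum of the generator `k`. -/
def exponentSum (k : κ) : FreeGroup κ →* Multiplicative ℤ :=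
  lift fun m => Multiplicative.ofAdd (if m = k then 1 else 0)

/-- Both sides are homomorphisms in `g`; on generators only the edge from 1 to `of k` contributes.
-/
lemma flow_cone_of (k : κ) (g : FreeGroup κ) :
    flow (cone (of k)) g = (exponentSum k g).toAdd := by
  let f : FreeGroup κ →* Multiplicative ℤ :=
    MonoidHom.mk' (fun g => Multiplicative.ofAdd (flow (cone (of k)) g)) fun g h => by
      rw [flow_mul (finite_cone_of k g) (finite_cone_of k h), ofAdd_add]
  suffices h : f = exponentSum k by rw [← h]; rfl
  refine ext_hom _ _ fun m => ?_
  simp only [f, MonoidHom.mk'_apply, exponentSum, lift_apply_of, EmbeddingLike.apply_eq_iff_eq]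
  by_cases hm : m = k
  · subst hm
    have h1 : ∀ u, u ≠ 1 → indic (cone (of m)) (u * of m) - indic (cone (of m)) u = 0 := by
      intro u hu
      exact sub_eq_zero.2 (indic_congr (mul_of_self_mem_cone_of_iff u hu))
    rw [flow, finsum_eq_single _ 1 h1]
    have h2 : (1 : FreeGroup κ) ∉ cone (of m) := by simp [cone]
    simp [indic, h2, mem_cone_self]
  · have h1 : ∀ u, indic (cone (of k)) (u * of m) - indic (cone (of k)) u = 0 :=
      fun u => sub_eq_zero.2 (indic_congr (mul_of_mem_cone_of_iff hm u))
    simp [flow, h1, hm]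

end HalfSpace

/-- Two distinct generators are independent in the abelianization, so they cannot both map into the
line spanned by `k₀`. -/
lemma exists_exponentSum_ne_zero {α κ : Type*} [DecidableEq α] [DecidableEq κ]
    (e : FreeGroup α ≃* FreeGroup κ) (k₀ : κ) {J : Set α} (hJ : J.Nontrivial) :
    ∃ k, k ≠ k₀ ∧ ∃ j ∈ J, (exponentSum k (e (of j))).toAdd ≠ 0 := by
  by_contra! hzero
  obtain ⟨i, hi, j, hj, hij⟩ := hJ
  let N : FreeGroup κ →* Multiplicative (κ →₀ ℤ) :=
    lift fun m => Multiplicative.ofAdd (Finsupp.single m 1)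
  have hN : ∀ k g, (N g).toAdd k = (exponentSum k g).toAdd := by
    intro k g
    let p : Multiplicative (κ →₀ ℤ) →* Multiplicative ℤ :=
      AddMonoidHom.toMultiplicative (Finsupp.applyAddHom k)
    have : p.comp N = exponentSum k := by
      refine ext_hom _ _ fun m => ?_
      simp [p, N, exponentSum, Finsupp.single_apply]
    rw [← this]
    rfl
  have hsingle : ∀ j ∈ J, (N (e (of j))).toAdd
      = Finsupp.single k₀ (exponentSum k₀ (e (of j))).toAdd := by
    intro j hj
    ext k
    rw [hN, Finsupp.single_apply]
    split_ifs with h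
    · rw [h]
    · exact hzero k (Ne.symm h) j hj
  -- Every homomorphism to ℤ factors through the abelianization. Applied to the coordinate functions
  -- of `i` and `j`, this formula asks for 1 = c_i a, 0 = c_j a and 1 = c_j b, which is impossible.
  have key : ∀ f : FreeGroup κ →* Multiplicative ℤ, ∀ j ∈ J,
      (f (e (of j))).toAdd = (exponentSum k₀ (e (of j))).toAdd * (f (of k₀)).toAdd := by
    intro f j hj
    let p : Multiplicative (κ →₀ ℤ) →* Multiplicative ℤ :=
      AddMonoidHom.toMultiplicative
        (Finsupp.liftAddHom fun k => (AddMonoidHom.mulRight (f (of k)).toAdd))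
    have : p.comp N = f := by
      refine ext_hom _ _ fun m => ?_
      simp [p, N]
    calc (f (e (of j))).toAdd = (p (N (e (of j)))).toAdd := by rw [← this]; rfl
      _ = Finsupp.liftAddHom (fun k => (AddMonoidHom.mulRight (f (of k)).toAdd))
            (N (e (of j))).toAdd := rfl
      _ = _ := by rw [hsingle j hj]; simp
  have h1 := key ((exponentSum i).comp e.symm.toMonoidHom) i hi
  have h2 := key ((exponentSum i).comp e.symm.toMonoidHom) j hj
  have h3 := key ((exponentSum j).comp e.symm.toMonoidHom) j hj
  have hi1 : (((exponentSum i).comp e.symm.toMonoidHom) (e (of i))).toAdd = 1 := by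
    simp [exponentSum]
  have hi2 : (((exponentSum i).comp e.symm.toMonoidHom) (e (of j))).toAdd = 0 := by
    simp [exponentSum, hij.symm]
  have hj1 : (((exponentSum j).comp e.symm.toMonoidHom) (e (of j))).toAdd = 1 := by
    simp [exponentSum]
  rw [hi1] at h1
  rw [hi2] at h2
  rw [hj1] at h3
  rcases mul_eq_zero.1 h2.symm with h | h
  · rw [h, zero_mul] at h3
    exact one_ne_zero h3
  · rw [h, mul_zero] at h1
    exact one_ne_zero h1

/-- Right multiplication by `b k₀` preserves the half-space of any other basis element `k`, so the
ends of its axes agree; `k` is chosen so that its exponent sum is nonzero on some generator from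
`J`. -/
lemma exists_isCutting_of_basis {α κ : Type*} [Finite α] [DecidableEq α]
    (b : FreeGroupBasis κ (FreeGroup α)) (k₀ : κ) {J : Set α} (hJ : J.Nontrivial) :
    ∃ S, IsCutting S (b k₀) J := by
  classical
  obtain ⟨k, hk, j, hj, hne⟩ := exists_exponentSum_ne_zero b.repr k₀ hJ
  refine ⟨b.repr ⁻¹' cone (of k), ?_, ?_, j, hj, ?_⟩
  · refine finite_edgeBoundary fun g => ?_
    refine ((finite_cone_of k (b.repr g)).preimage b.repr.injective.injOn).subset fun u hu => ?_
    simpa using hu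
  · have hinv : ∀ u, b.repr (u * b k₀) ∈ cone (of k) ↔ b.repr u ∈ cone (of k) := by
      intro u
      rw [_root_.map_mul, FreeGroupBasis.repr_apply_coe, mul_of_mem_cone_of_iff hk.symm]
    have hpow : ∀ (n : ℕ) u, b.repr (u * b k₀ ^ n) ∈ cone (of k) ↔ b.repr u ∈ cone (of k) := by
      intro n
      induction n with
      | zero => simp
      | succ n ih =>
        intro u
        rw [pow_succ, ← mul_assoc, hinv, ih]
    intro g
    refine Filter.Eventually.of_forall fun n => ?_
    have h := hpow n (g * (b k₀ ^ n)⁻¹)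
    rw [inv_mul_cancel_right] at h
    rw [Set.mem_preimage, Set.mem_preimage, hpow, h]
  · rw [← flow_cone_of] at hne
    convert hne using 1
    rw [flow, flow, ← finsum_comp_equiv b.repr.toEquiv]
    congr 1
    ext u
    congr 1
    refine indic_congr ?_
    rw [Set.mem_preimage, _root_.map_mul]
    rfl

/-- **Whitehead's cut vertex lemma** for primitive elements. -/
lemma exists_cut_of_isPrimitiveElement {α : Type} [Finite α] [DecidableEq α]
    {W : List (α × Bool)} {J : Set α} (hW : IsCyclicallyReduced W)
    (hprim : IsPrimitiveElement (mk W)) (hne : mk W ≠ 1)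
    (hwJ : mk W ∈ Subgroup.closure (of '' J)) (hJ : J.Nontrivial) :
    ∃ X A : Set (α × Bool), X.Subsingleton ∧ (∃ l ∈ A, l ∉ X ∧ l.1 ∈ J) ∧
      (∃ l ∉ A, l ∉ X ∧ l.1 ∈ J) ∧
      ∀ l m, IsTurn (W ++ W) l m → l ∉ X → m ∉ X → (l ∈ A ↔ m ∈ A) := by
  obtain ⟨κ, b, k, hk⟩ := hprim
  exact exists_cut_of_isCutting hW (hk ▸ exists_isCutting_of_basis b k hJ) hne hwJ hJ

end FreeGroup

namespace FreeGroup

/-! ### Elementary and Whitehead automorphisms. -/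

variable {α : Type*}

lemma mk_letter_mem_closure {K : Set α} {l : α × Bool} (hl : l.1 ∈ K) :
    mk [l] ∈ Subgroup.closure (of '' K) := by
  obtain ⟨a, s⟩ := l
  have h : of a ∈ Subgroup.closure (of '' K) := Subgroup.subset_closure ⟨a, hl, rfl⟩
  cases s
  · have := inv_mem h
    rwa [of, ← mk_invLetter] at this
  · exact h

lemma mk_mem_closure {K : Set α} {W : List (α × Bool)} (hW : ∀ l ∈ W, l.1 ∈ K) :
    mk W ∈ Subgroup.closure (of '' K) := by
  induction W with
  | nil => exact one_mem _
  | cons l W ih =>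
    rw [← List.singleton_append, ← mul_mk]
    exact mul_mem (mk_letter_mem_closure (hW l (by simp))) (ih fun m hm => hW m (by simp [hm]))

lemma map_eq_self_of_mem_closure {K : Set α} {f : FreeGroup α →* FreeGroup α}
    (hf : ∀ j ∈ K, f (of j) = of j) {g : FreeGroup α} (hg : g ∈ Subgroup.closure (of '' K)) :
    f g = g := by
  induction hg using Subgroup.closure_induction with
  | mem x hx =>
    obtain ⟨j, hj, rfl⟩ := hx
    exact hf j hj
  | one => exact _root_.map_one f
  | mul x y _ _ hx hy => rw [_root_.map_mul, hx, hy]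
  | inv x _ hx => rw [_root_.map_inv, hx]

lemma exists_mulEquiv_of_mul_of_mul (i : α) {u v : FreeGroup α}
    (hu : u ∈ Subgroup.closure (of '' {t | t ≠ i})) (hv : v ∈ Subgroup.closure (of '' {t | t ≠ i})) :
    ∃ Ψ : FreeGroup α ≃* FreeGroup α, Ψ (of i) = u * of i * v ∧ ∀ t, t ≠ i → Ψ (of t) = of t := by
  classical
  let f : FreeGroup α → FreeGroup α → FreeGroup α →* FreeGroup α := fun u v =>
    lift (Function.update of i (u * of i * v))
  have hfi : ∀ u v, f u v (of i) = u * of i * v := fun u v => by simp [f]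
  have hft : ∀ u v t, t ≠ i → f u v (of t) = of t := fun u v t ht => by simp [f, ht]
  have hfix : ∀ u v, ∀ g ∈ Subgroup.closure (of '' {t | t ≠ i}), f u v g = g :=
    fun u v g hg => map_eq_self_of_mem_closure (hft u v) hg
  have hcomp : ∀ u ∈ Subgroup.closure (of '' {t | t ≠ i}),
      ∀ v ∈ Subgroup.closure (of '' {t | t ≠ i}),
      (f u⁻¹ v⁻¹).comp (f u v) = MonoidHom.id _ := by
    intro u hu v hv
    refine ext_hom _ _ fun t => ?_
    by_cases ht : t = i
    · subst ht
      simp [hfi, hfix _ _ u hu, hfix _ _ v hv, mul_assoc]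
    · simp [hft _ _ t ht]
  refine ⟨(f u v).toMulEquiv (f u⁻¹ v⁻¹) (hcomp u hu v hv) ?_, hfi u v, hft u v⟩
  simpa using hcomp u⁻¹ (inv_mem hu) v⁻¹ (inv_mem hv)

lemma exists_mulEquiv_of_eq_letter (l : α × Bool) :
    ∃ Ψ : FreeGroup α ≃* FreeGroup α, Ψ (of l.1) = mk [l] ∧ ∀ t, t ≠ l.1 → Ψ (of t) = of t := by
  classical
  obtain ⟨i, s⟩ := l
  cases s
  · let f : FreeGroup α →* FreeGroup α := lift (Function.update of i (of i)⁻¹)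
    have hfi : f (of i) = (of i)⁻¹ := by simp [f]
    have hft : ∀ t, t ≠ i → f (of t) = of t := fun t ht => by simp [f, ht]
    have hcomp : f.comp f = MonoidHom.id _ := by
      refine ext_hom _ _ fun t => ?_
      by_cases ht : t = i
      · subst ht
        simp [hfi]
      · simp [hft t ht]
    exact ⟨f.toMulEquiv f hcomp hcomp, hfi.trans rfl, hft⟩
  · exact ⟨MulEquiv.refl _, rfl, fun _ _ => rfl⟩

section Whitehead

open Classical in
/-- The element `c` if the proposition `P` holds, and `1` otherwise. -/
noncomputable def onlyIf (c : FreeGroup α) (P : Prop) : FreeGroup α := if P then c else 1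

lemma onlyIf_of {c : FreeGroup α} {P : Prop} (h : P) : onlyIf c P = c := if_pos h

lemma onlyIf_of_not {c : FreeGroup α} {P : Prop} (h : ¬P) : onlyIf c P = 1 := if_neg h

lemma onlyIf_inv (c : FreeGroup α) (P : Prop) : onlyIf c⁻¹ P = (onlyIf c P)⁻¹ := by
  by_cases h : P <;> simp [onlyIf, h]

/-- The Whitehead endomorphism multiplying the letters of `A` by `c`. -/
noncomputable def whitehead (c : FreeGroup α) (A : Set (α × Bool)) : FreeGroup α →* FreeGroup α :=
  lift fun t => onlyIf c ((t, true) ∈ A) * of t * (onlyIf c ((t, false) ∈ A))⁻¹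

lemma whitehead_letter (c : FreeGroup α) (A : Set (α × Bool)) (l : α × Bool) :
    whitehead c A (mk [l]) = onlyIf c (l ∈ A) * mk [l] * (onlyIf c (invLetter l ∈ A))⁻¹ := by
  obtain ⟨t, s⟩ := l
  have h : whitehead c A (of t)
      = onlyIf c ((t, true) ∈ A) * of t * (onlyIf c ((t, false) ∈ A))⁻¹ := lift_apply_of
  cases s
  · have h2 : mk [(t, false)] = (of t)⁻¹ := rfl
    rw [h2, _root_.map_inv, h]
    simp [invLetter, mul_assoc]
  · exact h

lemma whitehead_letter_of_notMem {c : FreeGroup α} {A : Set (α × Bool)} {l : α × Bool}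
    (h : l ∉ A) (h' : invLetter l ∉ A) : whitehead c A (mk [l]) = mk [l] := by
  rw [whitehead_letter, onlyIf_of_not h, onlyIf_of_not h']
  simp

lemma whitehead_of_eq_self {c : FreeGroup α} {A : Set (α × Bool)} {j : α}
    (h : ∀ s, (j, s) ∉ A) : whitehead c A (of j) = of j :=
  whitehead_letter_of_notMem (l := (j, true)) (h _) (h _)

lemma whitehead_of_eq_conj {c : FreeGroup α} {A : Set (α × Bool)} {j : α}
    (h : ∀ s, (j, s) ∈ A) : whitehead c A (of j) = c * of j * c⁻¹ := by
  have := whitehead_letter c A (j, true)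
  rwa [onlyIf_of (h _), onlyIf_of (show invLetter (j, true) ∈ A from h _)] at this

lemma whitehead_comp_inv {c : FreeGroup α} {A : Set (α × Bool)} (hc : whitehead c A c = c) :
    (whitehead c A).comp (whitehead c⁻¹ A) = MonoidHom.id _ := by
  have hfix : ∀ P, whitehead c A (onlyIf c P) = onlyIf c P := by
    intro P
    by_cases h : P <;> simp [onlyIf, h, hc]
  refine ext_hom _ _ fun t => ?_
  have h : ∀ c, whitehead c A (of t)
      = onlyIf c ((t, true) ∈ A) * of t * (onlyIf c ((t, false) ∈ A))⁻¹ := fun c => lift_apply_of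
  simp [h, onlyIf_inv, hfix, mul_assoc]

/-- The Whitehead automorphism multiplying the letters of `A` by the letter `x`. -/
noncomputable def whiteheadEquiv {x : α × Bool} {A : Set (α × Bool)} (hx : x ∉ A)
    (hx' : invLetter x ∉ A) : FreeGroup α ≃* FreeGroup α :=
  (whitehead (mk [x]) A).toMulEquiv (whitehead (mk [x])⁻¹ A)
    (by
      have := whitehead_comp_inv (c := (mk [x])⁻¹) (A := A)
        (by rw [_root_.map_inv, whitehead_letter_of_notMem hx hx'])
      rwa [inv_inv] at this)
    (whitehead_comp_inv (whitehead_letter_of_notMem hx hx'))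

lemma whiteheadEquiv_apply {x : α × Bool} {A : Set (α × Bool)} (hx : x ∉ A)
    (hx' : invLetter x ∉ A) (g : FreeGroup α) :
    whiteheadEquiv hx hx' g = whitehead (mk [x]) A g := rfl

variable [DecidableEq α]

lemma norm_mk_letter_le (l : α × Bool) : norm (mk [l]) ≤ 1 := norm_mk_le

/-- The effect of a Whitehead automorphism on a word along which the membership of letters in `A`
is governed by the sides `S i` of its vertices. -/
lemma exists_whitehead_word {x : α × Bool} {A : Set (α × Bool)} (hx : x ∉ A)
    (hx' : invLetter x ∉ A) (y : ℕ → α × Bool) (S : ℕ → Prop) (m : ℕ)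
    (hS : ∀ i < m, y i ≠ x → (S i ↔ y i ∈ A))
    (hS' : ∀ i < m, invLetter (y i) ≠ x → (S (i + 1) ↔ invLetter (y i) ∈ A)) :
    ∃ h, whitehead (mk [x]) A (mk ((List.range m).map y))
        = onlyIf (mk [x]) (S 0) * h * (onlyIf (mk [x]) (S m))⁻¹ ∧
      norm h ≤ m ∧
      ((∃ i < m, y i = x ∧ S i ∨ invLetter (y i) = x ∧ S (i + 1)) → norm h < m) ∧
      ((∀ i < m, (y i = x → S i) ∧ (invLetter (y i) = x → S (i + 1))) →
        h ∈ Subgroup.closure (of '' {t | t ≠ x.1})) := by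
  induction m with
  | zero => exact ⟨1, by simp [← one_eq_mk], by simp, by simp, fun _ => one_mem _⟩
  | succ m ih =>
    obtain ⟨h, h1, h2, h3, h4⟩ := ih (fun i hi => hS i (by omega)) (fun i hi => hS' i (by omega))
    obtain ⟨f, hf, hf1, hf2, hf3⟩ : ∃ f, whitehead (mk [x]) A (mk [y m])
          = onlyIf (mk [x]) (S m) * f * (onlyIf (mk [x]) (S (m + 1)))⁻¹ ∧
        norm f ≤ 1 ∧ ((y m = x ∧ S m ∨ invLetter (y m) = x ∧ S (m + 1)) → f = 1) ∧
        (((y m = x → S m) ∧ (invLetter (y m) = x → S (m + 1))) →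
          f ∈ Subgroup.closure (of '' {t | t ≠ x.1})) := by
      have hm := hS m (by omega)
      have hm' := hS' m (by omega)
      -- An occurrence of `x` is fixed by the automorphism, but the factor `x` attached to its
      -- initial vertex accounts for it when that vertex is in `S`; then `f` is trivial. The case of
      -- the inverse letter is the mirror image, with the terminal vertex.
      by_cases hyx : y m = x
      · have hne : invLetter (y m) ≠ x := hyx ▸ invLetter_ne _
        have hS1 : ¬S (m + 1) := fun h => hx' (hyx ▸ (hm' hne).1 h)
        rw [hyx, whitehead_letter_of_notMem hx hx', onlyIf_of_not hS1]
        by_cases hSm : S m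
        · refine ⟨1, by simp [onlyIf_of hSm], by simp, fun _ => rfl, fun _ => one_mem _⟩
        · refine ⟨mk [x], by simp [onlyIf_of_not hSm], norm_mk_letter_le x, ?_, ?_⟩
          · rintro (h | h)
            · exact absurd h.2 hSm
            · exact absurd h.2 hS1
          · exact fun h => absurd (h.1 rfl) hSm
      · by_cases hyx' : invLetter (y m) = x
        · have hym : y m = invLetter x := invLetter_eq_iff.1 hyx'
          have hSm : ¬S m := fun h => hx' (hym ▸ (hm hyx).1 h)
          rw [hym, whitehead_letter_of_notMem hx' (by simpa using hx), onlyIf_of_not hSm]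
          by_cases hS1 : S (m + 1)
          · refine ⟨1, by simp only [onlyIf_of hS1, mk_invLetter]; simp, by simp, fun _ => rfl,
              fun _ => one_mem _⟩
          · refine ⟨mk [invLetter x], by simp [onlyIf_of_not hS1], norm_mk_letter_le _, ?_, ?_⟩
            · rintro (h | h)
              · exact absurd h.2 hSm
              · exact absurd h.2 hS1
            · exact fun h => absurd (h.2 (by simp)) hS1
        · refine ⟨mk [y m], ?_, norm_mk_letter_le _, ?_, fun _ => mk_letter_mem_closure ?_⟩
          · rw [whitehead_letter, hm hyx, hm' hyx']
          · rintro (h | h)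
            · exact absurd h.1 hyx
            · exact absurd h.1 hyx'
          · rintro h
            by_cases hs : (y m).2 = x.2
            · exact hyx (Prod.ext h hs)
            · refine hyx' (Prod.ext h ?_)
              cases h1 : (y m).2 <;> cases h2 : x.2 <;> simp_all
    refine ⟨h * f, ?_, (norm_mul_le h f).trans (by omega), ?_, ?_⟩
    · rw [List.range_succ, List.map_append, ← mul_mk, _root_.map_mul, h1, List.map_singleton, hf]
      simp [mul_assoc]
    · rintro ⟨i, hi, hgood⟩
      refine (norm_mul_le h f).trans_lt ?_
      by_cases him : i = m
      · subst him
        rw [hf2 hgood, norm_one]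
        omega
      · have := h3 ⟨i, by omega, hgood⟩
        omega
    · intro hall
      exact mul_mem (h4 fun i hi => hall i (by omega)) (hf3 (hall m (by omega)))

end Whitehead

end FreeGroup

lemma IsPrimitiveElement.map {G H : Type u} [Group G] [Group H] {g : G}
    (hg : IsPrimitiveElement g) (e : G ≃* H) : IsPrimitiveElement (e g) := by
  obtain ⟨ι, b, i, rfl⟩ := hg
  exact ⟨ι, b.map e, i, by simp⟩

lemma IsPrimitiveElement.ne_one {G : Type u} [Group G] {g : G} (hg : IsPrimitiveElement g) :
    g ≠ 1 := by
  classical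
  obtain ⟨ι, b, i, rfl⟩ := hg
  intro h
  have := congrArg b.repr h
  rw [FreeGroupBasis.repr_apply_coe, map_one] at this
  exact FreeGroup.of_ne_one i this

namespace FreeGroup

/-! ### Equivalence relative to a set of generators. -/

variable {α : Type}

/-- `h'` arises from `h` by an automorphism fixing the generators in `J` and by multiplication on
both sides with elements of the subgroup generated by `J`. -/
def RelEquiv (J : Set α) (h h' : FreeGroup α) : Prop :=
  ∃ Ψ : FreeGroup α ≃* FreeGroup α, (∀ j ∈ J, Ψ (of j) = of j) ∧
    ∃ u ∈ Subgroup.closure (of '' J), ∃ v ∈ Subgroup.closure (of '' J), h' = u * Ψ h * v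

/-- `h` together with the generators in `J` is part of a basis. -/
def ExtendsBasis (J : Set α) (h : FreeGroup α) : Prop :=
  ∃ Ψ : FreeGroup α ≃* FreeGroup α, (∀ j ∈ J, Ψ (of j) = of j) ∧ ∃ i ∉ J, Ψ (of i) = h

lemma closure_le_of_notMem {J : Set α} {i : α} (hi : i ∉ J) :
    Subgroup.closure (of '' J) ≤ Subgroup.closure (of '' {t | t ≠ i}) :=
  Subgroup.closure_mono (Set.image_mono fun j hj => by
    rintro rfl
    exact hi hj)

lemma RelEquiv.extendsBasis {J : Set α} {h h' : FreeGroup α} (hr : RelEquiv J h h')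
    (he : ExtendsBasis J h') : ExtendsBasis J h := by
  obtain ⟨Ψ, hΨ, u, hu, v, hv, rfl⟩ := hr
  obtain ⟨Θ, hΘ, i, hi, hΘi⟩ := he
  obtain ⟨Ξ, hΞi, hΞ⟩ := exists_mulEquiv_of_mul_of_mul i
    (closure_le_of_notMem hi (inv_mem hu)) (closure_le_of_notMem hi (inv_mem hv))
  refine ⟨Ξ.trans (Θ.trans Ψ.symm), fun j hj => ?_, i, hi, ?_⟩
  · have hji : j ≠ i := by
      rintro rfl
      exact hi hj
    simp only [MulEquiv.trans_apply, hΞ j hji, hΘ j hj, MulEquiv.symm_apply_eq, hΨ j hj]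
  · have hu' : Θ u = u := map_eq_self_of_mem_closure (f := Θ.toMonoidHom) hΘ hu
    have hv' : Θ v = v := map_eq_self_of_mem_closure (f := Θ.toMonoidHom) hΘ hv
    simp only [MulEquiv.trans_apply, hΞi, _root_.map_mul, hΘi, _root_.map_inv, hu', hv',
mul_assoc, inv_mul_cancel_left,
      mul_inv_cancel, mul_one, MulEquiv.symm_apply_apply]

/-- The left factor `u` is moved to the right by conjugation, where the quantifier over ⟨`J`⟩
absorbs it. -/
lemma RelEquiv.isPrimitiveElement {J : Set α} {h h' : FreeGroup α} (hr : RelEquiv J h h')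
    (hp : ∀ v ∈ Subgroup.closure (of '' J), IsPrimitiveElement (h * v))
    {c : FreeGroup α} (hc : c ∈ Subgroup.closure (of '' J)) : IsPrimitiveElement (h' * c) := by
  obtain ⟨Ψ, hΨ, u, hu, v, hv, rfl⟩ := hr
  have hfix : ∀ g ∈ Subgroup.closure (of '' J), Ψ g = g :=
    fun g hg => map_eq_self_of_mem_closure (f := Ψ.toMonoidHom) hΨ hg
  have h1 := ((hp (v * c * u) (mul_mem (mul_mem hv hc) hu)).map Ψ).map (MulAut.conj u)
  convert h1 using 1
  rw [MulAut.conj_apply, _root_.map_mul, hfix _ (mul_mem (mul_mem hv hc) hu)]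
  group

lemma relEquiv_mul_right {J : Set α} {h v : FreeGroup α}
    (hv : v ∈ Subgroup.closure (of '' J)) : RelEquiv J h (h * v) :=
  ⟨MulEquiv.refl _, fun _ _ => rfl, 1, one_mem _, v, hv, by simp⟩

lemma relEquiv_mul_left {J : Set α} {h u : FreeGroup α}
    (hu : u ∈ Subgroup.closure (of '' J)) : RelEquiv J h (u * h) :=
  ⟨MulEquiv.refl _, fun _ _ => rfl, u, hu, 1, one_mem _, by simp⟩

lemma onlyIf_mem {K : Subgroup (FreeGroup α)} {c : FreeGroup α} {P : Prop} (h : P → c ∈ K) :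
    onlyIf c P ∈ K := by
  by_cases hP : P
  · rw [onlyIf_of hP]
    exact h hP
  · rw [onlyIf_of_not hP]
    exact one_mem _

/-- A letter that occurs exactly once, between factors not involving it, can be made a generator by
undoing those factors; other generators are unaffected. -/
lemma relEquiv_of {J : Set α} {h u v : FreeGroup α} {Ψ : FreeGroup α ≃* FreeGroup α}
    (hΨ : ∀ j ∈ J, Ψ (of j) = of j) {l : α × Bool} (hl : l.1 ∉ J)
    (hu : u ∈ Subgroup.closure (of '' {t | t ≠ l.1}))
    (hv : v ∈ Subgroup.closure (of '' {t | t ≠ l.1})) (huv : Ψ h = u * mk [l] * v) :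
    RelEquiv J h (of l.1) := by
  obtain ⟨Φ, hΦl, hΦ⟩ := exists_mulEquiv_of_eq_letter l
  obtain ⟨Ξ, hΞl, hΞ⟩ := exists_mulEquiv_of_mul_of_mul l.1 hu hv
  have hfix : ∀ g ∈ Subgroup.closure (of '' {t | t ≠ l.1}), Φ g = g := fun g hg =>
    map_eq_self_of_mem_closure (f := Φ.toMonoidHom) hΦ hg
  refine ⟨Ψ.trans (Φ.symm.trans Ξ.symm), fun j hj => ?_, 1, one_mem _, 1, one_mem _, ?_⟩
  · have hjl : j ≠ l.1 := by
      rintro rfl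
      exact hl hj
    simp only [MulEquiv.trans_apply, hΨ j hj, MulEquiv.symm_apply_eq, hΞ j hjl, hΦ j hjl]
  · rw [one_mul, mul_one, MulEquiv.trans_apply, MulEquiv.trans_apply, huv,
      MulEquiv.eq_symm_apply, hΞl, MulEquiv.eq_symm_apply, _root_.map_mul, _root_.map_mul, hΦl,
      hfix u hu, hfix v hv]

variable [DecidableEq α]

/-- A set of letters closed under the turns of a word leads to a shorter relative representative. -/
lemma exists_relEquiv_of_closed {J : Set α} {y : ℕ → α × Bool} {m : ℕ} (hm : 2 ≤ m)
    {A : Set (α × Bool)}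
    (hAJ : ∀ l : α × Bool, l.1 ∈ J → l ∉ A)
    (hends : ¬(y 0 ∈ A ∧ invLetter (y (m - 1)) ∈ A))
    (hused : ∃ i < m, y i ∈ A ∨ invLetter (y i) ∈ A)
    (hclosed : ∀ i, i + 1 < m → (invLetter (y i) ∈ A ↔ y (i + 1) ∈ A)) :
    ∃ h', RelEquiv J (mk ((List.range m).map y)) h' ∧ norm h' < m := by
  -- If no such letter occurred, membership in `A` would pass from each letter to its inverse and
  -- across each turn. Then all letters of the word would lie in `A`, against `hends`.
  obtain ⟨l, hlA, hlA', i₀, hi₀, hyl⟩ : ∃ l ∈ A, invLetter l ∉ A ∧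
      ∃ i < m, y i = l ∨ invLetter (y i) = l := by
    by_contra! hno
    have hiff : ∀ i < m, (y i ∈ A ↔ invLetter (y i) ∈ A) := by
      intro i hi
      constructor
      · intro h
        by_contra h'
        exact (hno _ h h' i hi).1 rfl
      · intro h
        by_contra h'
        exact (hno _ h (by simpa using h') i hi).2 rfl
    have hall : ∀ i < m, (y i ∈ A ↔ y 0 ∈ A) := by
      intro i
      induction i with
      | zero => simp
      | succ i ih =>
        intro hi
        rw [← hclosed i hi, ← hiff i (by omega), ih (by omega)]
    obtain ⟨i, hi, h⟩ := hused
    rw [← hiff i hi, or_self, hall i hi] at h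
    exact hends ⟨h, (hiff _ (by omega)).1 ((hall _ (by omega)).2 h)⟩
  have hlJ : l.1 ∉ J := fun h => hAJ l h hlA
  let S : ℕ → Prop := fun i => (i < m ∧ y i ∈ A) ∨ (i = m ∧ invLetter (y (m - 1)) ∈ A)
  have hS : ∀ i < m, (S i ↔ y i ∈ A) := by
    intro i hi
    have : i ≠ m := by omega
    simp [S, hi, this]
  have hS' : ∀ i < m, (S (i + 1) ↔ invLetter (y i) ∈ A) := by
    intro i hi
    by_cases him : i + 1 < m
    · rw [hS _ him, hclosed i him]
    · have : m = i + 1 := by omega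
      subst this
      simp [S]
  -- The automorphism multiplies the rest of `A` by `l`. Since `A` is closed under turns, every
  -- occurrence of `l` or its inverse is cancelled inside the word.
  have hl : l ∉ A \ {l} := by simp
  have hl' : invLetter l ∉ A \ {l} := fun h => hlA' h.1
  obtain ⟨h, hh, -, hlt, hmem⟩ := exists_whitehead_word hl hl' y S m
    (fun i hi hne => by simp [hS i hi, hne]) (fun i hi hne => by simp [hS' i hi, hne])
  have hgood : ∀ i < m, (y i = l → S i) ∧ (invLetter (y i) = l → S (i + 1)) := fun i hi =>
    ⟨fun h => (hS i hi).2 (h ▸ hlA), fun h => (hS' i hi).2 (h ▸ hlA)⟩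
  have hlt := hlt ⟨i₀, hi₀, hyl.imp (fun h => ⟨h, (hgood i₀ hi₀).1 h⟩)
    (fun h => ⟨h, (hgood i₀ hi₀).2 h⟩)⟩
  have hmem := hmem hgood
  have hfixJ : ∀ j ∈ J, whiteheadEquiv hl hl' (of j) = of j := fun j hj =>
    whitehead_of_eq_self fun s hs => hAJ (j, s) hj hs.1
  have hone : norm (of l.1) < m := by
    rw [norm_of]
    omega
  have hS0 := hS 0 (by omega)
  have hSm : S m ↔ invLetter (y (m - 1)) ∈ A := by simp [S]
  -- If an end of the word lies in `A`, one copy of `l` or its inverse survives at that end and the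
  -- rest avoids it, so the word is equivalent to a single generator.
  by_cases h0 : S 0
  · have h1 : ¬S m := fun h => hends ⟨hS0.1 h0, hSm.1 h⟩
    refine ⟨of l.1, relEquiv_of hfixJ hlJ (one_mem _) hmem ?_, hone⟩
    rw [whiteheadEquiv_apply, hh, onlyIf_of h0, onlyIf_of_not h1]
    simp
  · by_cases h1 : S m
    · refine ⟨of l.1, relEquiv_of (l := invLetter l) hfixJ hlJ hmem (one_mem _) ?_, hone⟩
      rw [whiteheadEquiv_apply, hh, onlyIf_of_not h0, onlyIf_of h1, mk_invLetter]
      simp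
    · refine ⟨h, ⟨whiteheadEquiv hl hl', hfixJ, 1, one_mem _, 1, one_mem _, ?_⟩, hlt⟩
      rw [whiteheadEquiv_apply, hh, onlyIf_of_not h0, onlyIf_of_not h1]
      simp

end FreeGroup

namespace FreeGroup

/-! ### Hub words and the relative shortening argument. -/

variable {α : Type}

/-- The tail of a word in which the letter `(j₀, true)` alternates with all the letters of `Js`. -/
def hubTail (j₀ : α) : List α → List (α × Bool)
  | [] => [(j₀, true)]
  | j :: Js => (j, true) :: (j₀, true) :: (j, false) :: (j₀, true) :: hubTail j₀ Js

lemma isReduced_hubTail {j₀ : α} {Js : List α} (h : j₀ ∉ Js) :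
    IsReduced ((j₀, true) :: hubTail j₀ Js) := by
  induction Js with
  | nil => simp [hubTail]
  | cons j Js ih =>
    simp only [List.mem_cons, not_or] at h
    have := ih h.2
    simp [hubTail, isReduced_cons_cons, h.1, Ne.symm h.1, this]

lemma exists_hubTail_eq (j₀ : α) (Js : List α) : ∃ P, hubTail j₀ Js = P ++ [(j₀, true)] := by
  induction Js with
  | nil => exact ⟨[], rfl⟩
  | cons j Js ih =>
    obtain ⟨P, hP⟩ := ih
    exact ⟨(j, true) :: (j₀, true) :: (j, false) :: (j₀, true) :: P, by simp [hubTail, hP]⟩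

lemma fst_mem_of_mem_hubTail {j₀ : α} {Js : List α} {l : α × Bool} (hl : l ∈ hubTail j₀ Js) :
    l.1 = j₀ ∨ l.1 ∈ Js := by
  induction Js with
  | nil => simp_all [hubTail]
  | cons j Js ih =>
    simp only [hubTail, List.mem_cons] at hl ⊢
    rcases hl with rfl | rfl | rfl | rfl | hl <;> simp_all
    tauto

lemma infix_hubTail {j₀ j : α} {Js : List α} (hj : j ∈ Js) :
    [(j₀, true), (j, true), (j₀, true), (j, false), (j₀, true)] <:+: (j₀, true) :: hubTail j₀ Js := by
  induction Js with
  | nil => simp at hj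
  | cons i Js ih =>
    rcases List.mem_cons.1 hj with rfl | hj
    · exact ⟨[], hubTail j₀ Js, rfl⟩
    · refine (ih hj).trans ⟨[(j₀, true), (i, true), (j₀, true), (i, false)], [], by simp [hubTail]⟩

/-- After removing at most one letter, the turns of the hub word connect all its letters. -/
lemma exists_const_of_turns {j₀ : α} {Js : List α} {C : List (α × Bool)}
    (hC : (j₀, true) :: (j₀, true) :: hubTail j₀ Js <:+: C) {X A : Set (α × Bool)}
    (hX : X.Subsingleton)
    (hturn : ∀ l m, IsTurn C l m → l ∉ X → m ∉ X → (l ∈ A ↔ m ∈ A)) :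
    ∃ s : Prop, ∀ l : α × Bool, (l.1 = j₀ ∨ l.1 ∈ Js) → l ∉ X → (l ∈ A ↔ s) := by
  have hC' : (j₀, true) :: hubTail j₀ Js <:+: C := (List.suffix_cons _ _).isInfix.trans hC
  have h00 : IsTurn C (j₀, false) (j₀, true) := by
    refine List.IsInfix.trans ?_ hC
    exact ⟨[], hubTail j₀ Js, rfl⟩
  have hpos : ∀ j ∈ Js, ∀ s, IsTurn C (j, s) (j₀, true) := by
    intro j hj s
    refine List.IsInfix.trans ?_ ((infix_hubTail hj).trans hC')
    cases s
    · exact ⟨[(j₀, true)], [(j, false), (j₀, true)], rfl⟩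
    · exact ⟨[(j₀, true), (j, true), (j₀, true)], [], rfl⟩
  have hneg : ∀ j ∈ Js, ∀ s, IsTurn C (j₀, false) (j, s) := by
    intro j hj s
    refine List.IsInfix.trans ?_ ((infix_hubTail hj).trans hC')
    cases s
    · exact ⟨[(j₀, true), (j, true)], [(j₀, true)], rfl⟩
    · exact ⟨[], [(j₀, true), (j, false), (j₀, true)], rfl⟩
  -- Each letter from `Js` is adjacent to both `(j₀, true)` and `(j₀, false)`, and these two are
  -- adjacent. At most one of them is removed; the other serves as the hub.
  by_cases ht : (j₀, true) ∈ X
  · have hf : (j₀, false) ∉ X := fun h => by simpa using hX ht h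
    refine ⟨(j₀, false) ∈ A, ?_⟩
    rintro ⟨j, s⟩ (rfl | hj) hl
    · cases s
      · rfl
      · exact absurd ht hl
    · exact (hturn _ _ (hneg j hj s) hf hl).symm
  · refine ⟨(j₀, true) ∈ A, ?_⟩
    rintro ⟨j, s⟩ (rfl | hj) hl
    · cases s
      · exact hturn _ _ h00 hl ht
      · rfl
    · exact hturn _ _ (hpos j hj s) hl ht

lemma exists_eq_map_range {β : Type*} (d : β) (W : List β) :
    ∃ y : ℕ → β, W = (List.range W.length).map y := by
  refine ⟨fun i => W.getD i d, List.ext_getElem (by simp) fun i h1 h2 => by simp [h1]⟩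

lemma infix_map_range {β : Type*} (y : ℕ → β) {m i : ℕ} (hi : i + 1 < m) :
    [y i, y (i + 1)] <:+: (List.range m).map y := by
  obtain ⟨k, rfl⟩ := Nat.exists_eq_add_of_le hi
  refine ⟨(List.range i).map y, (List.range k).map fun t => y (i + 1 + 1 + t), ?_⟩
  simp [List.range_add, List.range_succ, Function.comp_def, add_assoc]

variable [DecidableEq α]

/-- A cut of the turns of a word leads to a shorter relative representative. -/
lemma exists_relEquiv_of_cut {J : Set α} {j₀ : α} (hj₀ : j₀ ∈ J) {y : ℕ → α × Bool} {m : ℕ}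
    (hm : 2 ≤ m) {X A : Set (α × Bool)}
    (hX : X.Subsingleton) (hXA : Disjoint X A) (hAJ : ∀ l : α × Bool, l.1 ∈ J → l ∉ A)
    (hused : ∃ i < m, y i ∈ A ∨ invLetter (y i) ∈ A)
    (hturn : ∀ i, i + 1 < m → invLetter (y i) ∉ X → y (i + 1) ∉ X →
      (invLetter (y i) ∈ A ↔ y (i + 1) ∈ A))
    (hstart : y 0 ∈ A → (j₀, false) ∈ X) (hend : invLetter (y (m - 1)) ∈ A → (j₀, true) ∈ X) :
    ∃ h', RelEquiv J (mk ((List.range m).map y)) h' ∧ norm h' < m := by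
  have hends : ¬(y 0 ∈ A ∧ invLetter (y (m - 1)) ∈ A) := by
    rintro ⟨h1, h2⟩
    simpa using hX (hstart h1) (hend h2)
  rcases hX.eq_empty_or_singleton with rfl | ⟨x, rfl⟩
  · exact exists_relEquiv_of_closed hm hAJ hends hused fun i hi => hturn i hi (by simp) (by simp)
  have hxA : x ∉ A := Set.disjoint_singleton_left.1 hXA
  simp only [Set.mem_singleton_iff] at hturn hstart hend
  -- A vertex of the word is on the side of `A` if either adjacent direction is; the two directions
  -- can disagree only when one of them is `x`.
  let S : ℕ → Prop := fun i => (i < m ∧ y i ∈ A) ∨ (0 < i ∧ invLetter (y (i - 1)) ∈ A)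
  have hS : ∀ i < m, y i ≠ x → (S i ↔ y i ∈ A) := by
    intro i hi hne
    refine ⟨?_, fun h => Or.inl ⟨hi, h⟩⟩
    rintro (h | ⟨h0, h⟩)
    · exact h.2
    · obtain ⟨i, rfl⟩ := Nat.exists_eq_add_one.2 h0
      rw [Nat.add_sub_cancel] at h
      exact (hturn i hi (by rintro rfl; exact hxA h) hne).1 h
  have hS' : ∀ i < m, invLetter (y i) ≠ x → (S (i + 1) ↔ invLetter (y i) ∈ A) := by
    intro i hi hne
    refine ⟨?_, fun h => Or.inr ⟨by omega, h⟩⟩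
    rintro (⟨h0, h⟩ | h)
    · exact (hturn i h0 hne (by intro h'; exact hxA (h' ▸ h))).2 h
    · exact h.2
  have hS0 : S 0 ↔ y 0 ∈ A := by
    simp only [S, lt_self_iff_false, false_and, or_false, and_iff_right_iff_imp]
    omega
  have hSm : S m ↔ invLetter (y (m - 1)) ∈ A := by
    simp only [S, lt_self_iff_false, false_and, false_or, and_iff_right_iff_imp]
    omega
  -- A Whitehead automorphism with multiplier `x` needs the inverse of `x` outside its set. Here the
  -- complement of `A` without `x` is used instead; it conjugates `J` by `x`, which the inner
  -- automorphism undoes.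
  by_cases hxA' : invLetter x ∈ A
  · have hxJ : x.1 ∉ J := fun h => hAJ (invLetter x) h hxA'
    have h0 : y 0 ∉ A := fun h => hxJ (hstart h ▸ hj₀)
    have hz : invLetter (y (m - 1)) ∉ A := fun h => hxJ (hend h ▸ hj₀)
    have hx : x ∉ {l | l ∉ A ∧ l ≠ x} := fun h => h.2 rfl
    have hx' : invLetter x ∉ {l | l ∉ A ∧ l ≠ x} := fun h => h.1 hxA'
    by_cases hgood : ∃ i < m, y i = x ∧ ¬S i ∨ invLetter (y i) = x ∧ ¬S (i + 1)
    · obtain ⟨h, hh, -, hlt, -⟩ := exists_whitehead_word hx hx' y (fun i => ¬S i) m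
        (fun i hi hne => by simp [hS i hi hne, hne]) (fun i hi hne => by simp [hS' i hi hne, hne])
      refine ⟨h, ⟨(whiteheadEquiv hx hx').trans (MulAut.conj (mk [x])⁻¹), fun j hj => ?_, 1,
        one_mem _, 1, one_mem _, ?_⟩, hlt hgood⟩
      · have hj' : ∀ s, (j, s) ∈ {l | l ∉ A ∧ l ≠ x} := by
          refine fun s => ⟨hAJ (j, s) hj, ?_⟩
          rintro rfl
          exact hxJ hj
        rw [MulEquiv.trans_apply, whiteheadEquiv_apply, whitehead_of_eq_conj hj', MulAut.conj_apply]
        group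
      · rw [MulEquiv.trans_apply, whiteheadEquiv_apply, hh, onlyIf_of (by rwa [hS0]),
          onlyIf_of (by rwa [hSm]), MulAut.conj_apply]
        group
    · push Not at hgood
      have hy0 : y 0 ≠ x := fun h => h0 (hS0.1 ((hgood 0 (by omega)).1 h))
      have hym : invLetter (y (m - 1)) ≠ x := fun h => hz <| hSm.1 <| by
        have := (hgood (m - 1) (by omega)).2 h
        rwa [Nat.sub_add_cancel (by omega)] at this
      -- With no vertex available for shortening, every turn at `x` leads into `A` or back to `x`,
      -- so adding `x` makes the set closed.
      refine exists_relEquiv_of_closed hm (A := insert x A) ?_ ?_ ?_ ?_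
      · rintro l hl (rfl | h)
        · exact hxJ hl
        · exact hAJ l hl h
      · rintro ⟨h | h, -⟩
        · exact hy0 h
        · exact h0 h
      · obtain ⟨i, hi, h⟩ := hused
        exact ⟨i, hi, h.imp (Set.mem_insert_of_mem _) (Set.mem_insert_of_mem _)⟩
      · intro i hi
        have h1 := hS (i + 1) hi
        have h2 := hS' i (by omega)
        have h3 := (hgood (i + 1) hi).1
        have h4 := (hgood i (by omega)).2
        simp only [Set.mem_insert_iff]
        by_cases h6 : y (i + 1) = x <;> by_cases h7 : invLetter (y i) = x <;> simp_all
  · by_cases hgood : ∃ i < m, y i = x ∧ S i ∨ invLetter (y i) = x ∧ S (i + 1)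
    · obtain ⟨h, hh, -, hlt, -⟩ := exists_whitehead_word hxA hxA' y S m hS hS'
      -- An end of the word in `A` forces `x` to be a letter over `j₀`, so the factor left at that
      -- end is absorbed by ⟨`J`⟩.
      have hu : onlyIf (mk [x]) (S 0) ∈ Subgroup.closure (of '' J) := onlyIf_mem fun h =>
        mk_letter_mem_closure (hstart (hS0.1 h) ▸ hj₀)
      have hv : onlyIf (mk [x]) (S m) ∈ Subgroup.closure (of '' J) := onlyIf_mem fun h =>
        mk_letter_mem_closure (hend (hSm.1 h) ▸ hj₀)
      refine ⟨h, ⟨whiteheadEquiv hxA hxA', fun j hj => ?_, _, inv_mem hu, _, hv, ?_⟩, hlt hgood⟩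
      · exact whitehead_of_eq_self fun s => hAJ (j, s) hj
      · rw [whiteheadEquiv_apply, hh]
        group
    · push Not at hgood
      -- Here no turn at `x` leads into `A`, so `A` itself is closed.
      refine exists_relEquiv_of_closed hm hAJ hends hused fun i hi => ?_
      have h1 := hS (i + 1) hi
      have h2 := hS' i (by omega)
      have h3 := (hgood (i + 1) hi).1
      have h4 := (hgood i (by omega)).2
      by_cases h6 : y (i + 1) = x <;> by_cases h7 : invLetter (y i) = x <;> simp_all

/-- Induction on the length of `h` up to `RelEquiv`, which transports both hypothesis and
conclusion. For a shortest `h` of length at least two, the cut vertex lemma for `h` times a hub word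
gives a shorter representative, a contradiction. -/
theorem extendsBasis_of_isPrimitiveElement [Finite α] {J : Set α} {j₀ : α} (hj₀ : j₀ ∈ J)
    (h : FreeGroup α)
    (hp : ∀ v ∈ Subgroup.closure (of '' J), IsPrimitiveElement (h * v)) : ExtendsBasis J h := by
  induction hn : norm h using Nat.strong_induction_on generalizing h with
  | h n ih =>
  subst hn
  by_cases hshort : ∃ h', RelEquiv J h h' ∧ norm h' < norm h
  · obtain ⟨h', hr, hlt⟩ := hshort
    exact hr.extendsBasis (ih _ hlt h' (fun v hv => hr.isPrimitiveElement hp hv) rfl)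
  push Not at hshort
  have hhJ : h ∉ Subgroup.closure (of '' J) := fun hh =>
    (hp h⁻¹ (inv_mem hh)).ne_one (mul_inv_cancel h)
  obtain ⟨y, hy⟩ := exists_eq_map_range (j₀, true) h.toWord
  generalize hm : h.toWord.length = m at hy
  have hnorm : norm h = m := hm
  have hmk : h = mk ((List.range m).map y) := by rw [← hy, mk_toWord]
  have hred : IsReduced ((List.range m).map y) := hy ▸ isReduced_toWord
  have hletters : ∀ i < m, y i ∈ (List.range m).map y := fun i hi =>
    List.mem_map_of_mem (List.mem_range.2 hi)
  match m, hnorm with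
  | 0, hnorm =>
    exact absurd (norm_eq_zero.1 hnorm ▸ one_mem _) hhJ
  | 1, hnorm =>
    have h1 : h = mk [y 0] := by simpa using hmk
    obtain ⟨Ψ, hΨ, hΨ'⟩ := exists_mulEquiv_of_eq_letter (y 0)
    have hyJ : (y 0).1 ∉ J := fun hJ => hhJ (h1 ▸ mk_letter_mem_closure hJ)
    exact ⟨Ψ, fun j hj => hΨ' j (by rintro rfl; exact hyJ hj), (y 0).1, hyJ, by rw [hΨ, h1]⟩
  | k + 2, hnorm =>
    exfalso
    -- A `J`-letter at either end could be stripped by multiplication with ⟨`J`⟩. Hence nothing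
    -- cancels when the hub word is attached, even cyclically.
    have hy0 : (y 0).1 ∉ J := by
      intro hJ
      refine absurd (hshort ((mk [y 0])⁻¹ * h)
        (relEquiv_mul_left (inv_mem (mk_letter_mem_closure hJ)))) (not_le.2 ?_)
      have : (mk [y 0])⁻¹ * h = mk ((List.range (k + 1)).map fun i => y (i + 1)) := by
        rw [inv_mul_eq_iff_eq_mul, mul_mk, hmk, List.range_succ_eq_map]
        simp [Function.comp_def]
      rw [this, hnorm]
      exact norm_mk_le.trans_lt (by simp)
    have hyl : (y (k + 1)).1 ∉ J := by
      intro hJ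
      refine absurd (hshort (h * (mk [y (k + 1)])⁻¹)
        (relEquiv_mul_right (inv_mem (mk_letter_mem_closure hJ)))) (not_le.2 ?_)
      have : h * (mk [y (k + 1)])⁻¹ = mk ((List.range (k + 1)).map y) := by
        rw [mul_inv_eq_iff_eq_mul, mul_mk, hmk, List.range_succ]
        simp
      rw [this, hnorm]
      exact norm_mk_le.trans_lt (by simp)
    let Js : List α := (Set.toFinite (J \ {j₀})).toFinset.toList
    have hJs : ∀ j, j ∈ Js ↔ j ∈ J ∧ j ≠ j₀ := fun j => by simp [Js]
    let V : List (α × Bool) := (j₀, true) :: (j₀, true) :: hubTail j₀ Js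
    obtain ⟨P, hP⟩ := exists_hubTail_eq j₀ Js
    have hVred : IsReduced V := isReduced_cons_cons.2
      ⟨by simp, isReduced_hubTail fun hmem => ((hJs _).1 hmem).2 rfl⟩
    have hVJ : ∀ l ∈ V, l.1 ∈ J := by
      intro l hl
      simp only [V, List.mem_cons] at hl
      rcases hl with rfl | rfl | hl
      · exact hj₀
      · exact hj₀
      · rcases fst_mem_of_mem_hubTail hl with h | h
        · exact h ▸ hj₀
        · exact ((hJs _).1 h).1
    let U : List (α × Bool) := (List.range (k + 2)).map y
    have hUlast : U = (List.range (k + 1)).map y ++ [y (k + 1)] := by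
      simp [U, List.range_succ]
    have hUhead : U = y 0 :: (List.range (k + 1)).map fun i => y (i + 1) := by
      simp [U, List.range_succ_eq_map, Function.comp_def]
    have hVlast : V = ((j₀, true) :: (j₀, true) :: P) ++ [(j₀, true)] := by
      simp [V, hP]
    have hcyc : IsCyclicallyReduced (U ++ V) := by
      refine ⟨hred.append hVred ?_, ?_⟩
      · intro a ha b hb hab
        rw [show (List.range (k + 2)).map y = U from rfl, hUlast] at ha
        have ha : y (k + 1) = a := by simpa using ha
        have hb : (j₀, true) = b := by simpa [V] using hb
        subst ha hb
        exact absurd (hab ▸ hj₀) hyl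
      · intro a ha b hb hab
        rw [hVlast, ← List.append_assoc, List.getLast?_concat] at ha
        have ha : (j₀, true) = a := by simpa using ha
        rw [hUhead] at hb
        have hb : y 0 = b := by simpa using hb
        subst ha hb
        exact absurd (hab ▸ hj₀) hy0
    have hprim : IsPrimitiveElement (mk (U ++ V)) := by
      rw [← mul_mk, ← hmk]
      exact hp _ (mk_mem_closure hVJ)
    -- Restricting to occurring generators ensures that the cut separates letters in use, rather
    -- than isolated vertices of the Whitehead graph.
    let K : Set α := {t | ∃ l ∈ U ++ V, l.1 = t}
    have hyK : ∀ i < k + 2, (y i).1 ∈ K := fun i hi =>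
      ⟨y i, List.mem_append_left _ (hletters i hi), rfl⟩
    have hK : K.Nontrivial := by
      refine ⟨(y 0).1, hyK 0 (by omega), j₀, ⟨(j₀, true), by simp [V], rfl⟩, ?_⟩
      intro h
      exact hy0 (h ▸ hj₀)
    obtain ⟨X, A, hX, ⟨l₁, hl₁A, hl₁X, hl₁K⟩, ⟨l₂, hl₂A, hl₂X, hl₂K⟩, hturn⟩ :=
      exists_cut_of_isPrimitiveElement hcyc hprim hprim.ne_one
        (mk_mem_closure (K := K) fun l hl => ⟨l, hl, rfl⟩) hK
    obtain ⟨s, hs⟩ := exists_const_of_turns (j₀ := j₀) (Js := Js) (C := (U ++ V) ++ (U ++ V))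
      ⟨U, U ++ V, by simp [V]⟩ hX hturn
    have hs : ∀ l : α × Bool, l.1 ∈ J → l ∉ X → (l ∈ A ↔ s) := fun l hl =>
      hs l (by rw [hJs]; tauto)
    -- All `J`-letters outside `X` lie on one side, by the hub; `B` is the other side. A used letter
    -- in `B` must then come from `U`.
    obtain ⟨B, hBJ, hXB, ⟨l, hlB, hlX, hlK⟩, hturnB⟩ : ∃ B : Set (α × Bool),
        (∀ l : α × Bool, l.1 ∈ J → l ∉ B) ∧ Disjoint X B ∧ (∃ l ∈ B, l ∉ X ∧ l.1 ∈ K) ∧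
        ∀ l m, IsTurn ((U ++ V) ++ (U ++ V)) l m → l ∉ X → m ∉ X → (l ∈ B ↔ m ∈ B) := by
      by_cases hst : s
      · refine ⟨Aᶜ \ X, fun l hl h => h.1 ((hs l hl h.2).2 hst), Set.disjoint_sdiff_right,
          ⟨l₂, ⟨hl₂A, hl₂X⟩, hl₂X, hl₂K⟩, fun l m hlm hl hm => ?_⟩
        simp [hl, hm, hturn l m hlm hl hm]
      · refine ⟨A \ X, fun l hl h => hst ((hs l hl h.2).1 h.1), Set.disjoint_sdiff_right,
          ⟨l₁, ⟨hl₁A, hl₁X⟩, hl₁X, hl₁K⟩, fun l m hlm hl hm => ?_⟩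
        simp [hl, hm, hturn l m hlm hl hm]
    suffices hex : ∃ h', RelEquiv J (mk ((List.range (k + 2)).map y)) h' ∧ norm h' < k + 2 by
      obtain ⟨h', hr, hlt⟩ := hex
      rw [← hmk] at hr
      exact absurd (hshort h' hr) (not_le.2 (hnorm ▸ hlt))
    refine exists_relEquiv_of_cut hj₀ (y := y) (m := k + 2) (by omega) hX hXB hBJ ?_ ?_ ?_ ?_
    · obtain ⟨l', hl', hll'⟩ := hlK
      rcases List.mem_append.1 hl' with hl' | hl'
      · obtain ⟨i, hi, rfl⟩ := List.mem_map.1 hl'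
        refine ⟨i, List.mem_range.1 hi, ?_⟩
        by_cases hsnd : (y i).2 = l.2
        · exact Or.inl (Prod.ext hll' hsnd ▸ hlB)
        · refine Or.inr ?_
          have : invLetter (y i) = l := by
            refine Prod.ext hll' ?_
            cases h1 : (y i).2 <;> cases h2 : l.2 <;> simp_all
          rwa [this]
      · exact absurd hlB (hBJ l (hll' ▸ hVJ l' hl'))
    · intro i hi
      refine hturnB _ _ ?_
      rw [IsTurn, invLetter_invLetter]
      exact (infix_map_range y hi).trans ⟨[], V ++ (U ++ V), by simp [U]⟩
    · intro h0
      by_contra hnot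
      have hy0X : y 0 ∉ X := fun h => Set.disjoint_left.1 hXB h h0
      -- The turn is the cyclic one from the last letter `(j₀, true)` of `V` to the first letter of
      -- `U`.
      refine hBJ (j₀, false) hj₀ ((hturnB _ _ ?_ hnot hy0X).2 h0)
      refine ⟨U ++ ((j₀, true) :: (j₀, true) :: P),
        ((List.range (k + 1)).map fun i => y (i + 1)) ++ V, ?_⟩
      have : U ++ V ++ (U ++ V) = U ++ (((j₀, true) :: (j₀, true) :: P) ++ [(j₀, true)]) ++
          ((y 0 :: (List.range (k + 1)).map fun i => y (i + 1)) ++ V) := by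
        rw [← hVlast, ← hUhead]
      rw [this]
      simp [invLetter]
    · intro h0
      by_contra hnot
      have hymX : invLetter (y (k + 1)) ∉ X := fun h => Set.disjoint_left.1 hXB h h0
      refine hBJ (j₀, true) hj₀ ((hturnB _ _ ?_ hymX hnot).1 h0)
      refine ⟨(List.range (k + 1)).map y, ((j₀, true) :: hubTail j₀ Js) ++ (U ++ V), ?_⟩
      rw [hUlast]
      simp [V]

end FreeGroup

/-! ### Extending families to bases, and the theorem. -/

namespace FreeGroup

/-- Finitely many generators involve finitely many basis elements; any further one would lie in
their span, which its exponent sum kills. -/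
lemma finite_of_basis_of_fg {ι G : Type*} [Group G] (b : FreeGroupBasis ι G) (hG : Group.FG G) :
    Finite ι := by
  classical
  obtain ⟨S, hS⟩ := hG.out
  let K : Set ι := ⋃ s ∈ S, {t | ∃ l ∈ (b.repr s).toWord, l.1 = t}
  have hK : K.Finite := S.finite_toSet.biUnion fun s _ =>
    ((b.repr s).toWord.finite_toSet.image Prod.fst).subset fun t ht => ht
  have hle : (⊤ : Subgroup G) ≤ (Subgroup.closure (of '' K)).comap b.repr.toMonoidHom := by
    rw [← hS, Subgroup.closure_le]
    intro s hs
    have : mk (b.repr s).toWord ∈ Subgroup.closure (of '' K) :=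
      mk_mem_closure fun l hl => Set.mem_biUnion hs ⟨l, hl, rfl⟩
    rwa [mk_toWord] at this
  refine Set.finite_univ_iff.1 (hK.subset fun i _ => ?_)
  by_contra hi
  have h1 : of i ∈ Subgroup.closure (of '' K) := by
    have := hle (Subgroup.mem_top (b i))
    rwa [Subgroup.mem_comap, MulEquiv.coe_toMonoidHom, FreeGroupBasis.repr_apply_coe] at this
  have h2 : Subgroup.closure (of '' K) ≤ (exponentSum i).ker := by
    rw [Subgroup.closure_le]
    rintro - ⟨j, hj, rfl⟩
    have hji : j ≠ i := by
      rintro rfl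
      exact hi hj
    simp [exponentSum, MonoidHom.mem_ker, hji]
  have h3 : exponentSum i (of i) = 1 := h2 h1
  simp [exponentSum] at h3

/-- A family each of whose members stays primitive after multiplication by any element generated by
its predecessors extends to a basis. -/
lemma exists_basis_extending {α : Type} [Finite α] (k : ℕ) (b : Fin k → FreeGroup α)
    (hb : ∀ j, ∀ v ∈ Subgroup.closure (b '' {i | i < j}), IsPrimitiveElement (b j * v)) :
    ∃ (ι : Type) (c : FreeGroupBasis ι (FreeGroup α)) (e : Fin k ↪ ι), ∀ i, c (e i) = b i := by
  induction k with
  | zero => exact ⟨α, FreeGroupBasis.ofFreeGroup α, ⟨Fin.elim0, fun i => i.elim0⟩, fun i => i.elim0⟩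
  | succ k ih =>
    -- The first member is handled separately, because the relative step needs a generator `j₀`
    -- already in `J`.
    rcases k with - | k
    · obtain ⟨ι, c, i, hi⟩ := hb 0 1 (one_mem _)
      refine ⟨ι, c, ⟨fun _ => i, fun p q _ => Fin.ext (by omega)⟩, fun j => ?_⟩
      rw [Fin.fin_one_eq_zero j]
      exact hi.trans (mul_one _)
    obtain ⟨ι, c, e, he⟩ := ih (fun i => b i.castSucc) fun j v hv => by
      refine hb j.castSucc v (Subgroup.closure_mono ?_ hv)
      rintro - ⟨i, hi, rfl⟩
      exact ⟨i.castSucc, by simpa using hi, rfl⟩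
    classical
    have : Finite ι := finite_of_basis_of_fg c inferInstance
    have hsymm : ∀ i, c.repr.symm (of i) = c i := fun i => by
      rw [MulEquiv.symm_apply_eq, FreeGroupBasis.repr_apply_coe]
    have hprim : ∀ v ∈ Subgroup.closure (of '' Set.range e),
        IsPrimitiveElement (c.repr (b (Fin.last _)) * v) := by
      intro v hv
      have hv' : c.repr.symm v ∈ Subgroup.closure (b '' {i | i < Fin.last _}) := by
        have hle : Subgroup.closure (of '' Set.range e) ≤
            (Subgroup.closure (b '' {i | i < Fin.last _})).comap c.repr.symm.toMonoidHom := by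
          rw [Subgroup.closure_le]
          rintro - ⟨-, ⟨i, rfl⟩, rfl⟩
          refine Subgroup.subset_closure ⟨i.castSucc, Fin.castSucc_lt_last i, ?_⟩
          exact ((hsymm _).trans (he i)).symm
        exact hle hv
      have := (hb _ _ hv').map c.repr
      rwa [_root_.map_mul, MulEquiv.apply_symm_apply] at this
    obtain ⟨Ψ, hΨ, i, hi, hΨi⟩ :=
      extendsBasis_of_isPrimitiveElement (Set.mem_range_self (0 : Fin (k + 1))) _ hprim
    refine ⟨ι, (FreeGroupBasis.ofFreeGroup ι).map (Ψ.trans c.repr.symm),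
      ⟨Fin.snoc e i, Fin.snoc_injective_iff.2 ⟨e.injective, hi⟩⟩, fun j => ?_⟩
    refine Fin.lastCases ?_ (fun j => ?_) j
    · simp [hΨi]
    · simp [hΨ _ (Set.mem_range_self j), hsymm, he]

end FreeGroup

theorem mainTheorem1 (n : ℕ) (H : Subgroup (FreeGroup (Fin n))) (hH : H.FG)
    (hprim : ∀ h : H, IsPrimitiveElement h → IsPrimitiveElement (h : FreeGroup (Fin n))) :
    IsFreeFactor H := by
  have b₀ := IsFreeGroup.basis H
  have : Finite (IsFreeGroup.Generators H) :=
    FreeGroup.finite_of_basis_of_fg b₀ ((Group.fg_iff_subgroup_fg H).2 hH)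
  obtain ⟨k, ⟨σ⟩⟩ := Finite.exists_equiv_fin (IsFreeGroup.Generators H)
  let b := b₀.reindex σ
  have hsymm : ∀ i, b.repr.symm (FreeGroup.of i) = b i := fun i => by
    rw [MulEquiv.symm_apply_eq, FreeGroupBasis.repr_apply_coe]
  have hb : ∀ j, ∀ v ∈ Subgroup.closure ((fun i => (b i : FreeGroup (Fin n))) '' {i | i < j}),
      IsPrimitiveElement ((b j : FreeGroup (Fin n)) * v) := by
    intro j v hv
    have hle : Subgroup.closure ((fun i => (b i : FreeGroup (Fin n))) '' {i | i < j}) ≤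
        (Subgroup.closure (FreeGroup.of '' {i | i ≠ j})).map
          (H.subtype.comp b.repr.symm.toMonoidHom) := by
      rw [Subgroup.closure_le]
      rintro - ⟨i, hi, rfl⟩
      exact ⟨FreeGroup.of i, Subgroup.subset_closure ⟨i, ne_of_lt hi, rfl⟩,
        congrArg Subtype.val (hsymm i)⟩
    obtain ⟨u, hu, rfl⟩ := hle hv
    -- The product of the `j`-th basis element with a word in the others is its image under an
    -- automorphism of `H`, hence primitive in `H`.
    obtain ⟨Ψ, hΨ, -⟩ := FreeGroup.exists_mulEquiv_of_mul_of_mul j (one_mem _) hu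
    have h1 : IsPrimitiveElement (FreeGroup.of j) :=
      ⟨Fin k, FreeGroupBasis.ofFreeGroup _, j, by simp⟩
    have h2 := hprim _ ((h1.map Ψ).map b.repr.symm)
    rw [hΨ, one_mul, map_mul, hsymm] at h2
    exact h2
  obtain ⟨ι, c, e, he⟩ := FreeGroup.exists_basis_extending k _ hb
  classical
  let τ : Fin k ⊕ ↥(Set.range e)ᶜ ≃ ι :=
    ((Equiv.ofInjective e e.injective).sumCongr (Equiv.refl _)).trans (Equiv.Set.sumCompl _)
  exact ⟨Fin k, ↥(Set.range e)ᶜ, b, c.reindex τ.symm, fun i => by simpa [τ] using he i⟩
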